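/- **Theorem 1.2.** For an integer $m$ let $\mathfrak p_3(m)$ be the number of $3$-colored partitions of $m$, that is, partitions of $m$ in which each part carries one of $3$ colors (so $\mathfrak p_3(0)=1$ and $\mathfrak p_3(m)=0$ for $m<0$). Let $T_k:=\frac{k^2+k}{2}$, let $B_{m}$ be the $m$-th Bernoulli number, let $\sigma_{m}(n):=\sum_{d\mid n}d^{m}$, and for integers $v\ge 2$ and $n,k\geq 0$ put $$ \mathcal{E}_v(n,k):=\sum_{\substack{r,s\geq0\\ r+s=v}}\frac{(-1)^{r}}{8^v}\, \frac{\Gamma\left(v-\frac{3}{2}\right)\Gamma\left(v+\frac{3}{2}\right)}{s!\,r!\,\Gamma\left(r-\frac{3}{2}\right)\Gamma\left(s+\frac{3}{2}\right)}(2k+1)^{2s+1}\left(8n-(2k+1)^2\right)^{r}. $$ (1) If $v\in\{2,3,4,5,7\}$, then for every positive integer $n$ we have $\mathcal{E}_v(n,0)\ne 0$ and $$ \mathfrak{p}_3(n)=\frac{1}{\mathcal{E}_v(n,0)}\left(-\frac{4v\, \alpha_v}{B_{2v}}\,\sigma_{2v-1}(n)+\sum_{k\geq 1}\,(-1)^{k+1}\mathcal{E}_v(n,k)\,\mathfrak{p}_3\left(n-T_k\right)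 \right), $$ where $$\alpha_2=\tfrac{1}{64},\quad \alpha_3=\tfrac{1}{128},\quad \alpha_4=\tfrac{15}{4096},\quad \alpha_5=\tfrac{7}{4096},\quad \alpha_7=\tfrac{99}{262144}.$$ (2) If $v\in\{6,8,9,10,11,13\}$, then there is a unique cusp form $\Delta_{2v}=\sum_{n\ge1}\tau_{2v}(n)q^n$ of weight $2v$ for $\mathrm{SL}_2(\mathbb Z)$, where $q=e^{2\pi i z}$, with $\tau_{2v}(1)=1$, and for every positive integer $n$ we have $\mathcal{E}_v(n,0)\ne 0$ and $$ \mathfrak{p}_3(n)=\frac{1}{\mathcal{E}_v(n,0)}\left(-\frac{4v\, \alpha_v}{B_{2v}}\,\sigma_{2v-1}(n)+\beta_v\, \tau_{2v}(n)+\sum_{k\geq 1}\,(-1)^{k+1}\mathcal{E}_v(n,k)\,\mathfrak{p}_3\left(n-T_k\right) \right), $$ where $$\begin{array}{c|cccccc} v & 6 & 8 & 9 & 10 & 11 & 13\\ \hline \alpha_v & \frac{105}{131072} & \frac{3003}{16777216} & \frac{715}{8388608} & \frac{21879}{536870912} & \frac{20995}{1073741824} & \frac{156009}{34359738368}\\ \beta_v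 & -\frac{51051}{22112} & -\frac{9429849}{1851904} & -\frac{324385347}{44919808} & -\frac{328502311137}{22886612992} & -\frac{318771027861}{10182066176} & -\frac{162957690002835}{1379781312512} \end{array}$$ -/

import Mathlib

open scoped MatrixGroups

/-- A `t`-colored partition of `n`: a finite multiset of parts, each part being a positive
integer together with one of `t` colors, whose sizes add up to `n`. (For negative `n` there
are none, and for `n = 0` there is only the empty one.) -/
def ColoredPartition (t : ℕ) (n : ℤ) : Type :=
  {m : Multiset (ℕ+ × Fin t) // (m.map fun p => ((p.1 : ℕ) : ℤ)).sum = n}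

/-- The number of `t`-colored partitions of `n`; it is `0` for `n < 0`. -/
noncomputable def coloredPartitionCount (t : ℕ) (n : ℤ) : ℕ :=
  Nat.card (ColoredPartition t n)

/-- The triangular number `T_k = (k² + k) / 2`. -/
def triangular (k : ℕ) : ℕ := (k ^ 2 + k) / 2

/-- The coefficient `𝓔_v(n, k)`: the sum over pairs `x = (r, s)` of natural numbers with
`r + s = v`. -/
noncomputable def calE (v n k : ℕ) : ℝ :=
  ∑ x ∈ Finset.HasAntidiagonal.antidiagonal v,
    (-1 : ℝ) ^ x.1 / 8 ^ v *
      (Real.Gamma ((v : ℝ) - 3 / 2) * Real.Gamma ((v : ℝ) + 3 / 2) /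
        ((x.2.factorial : ℝ) * (x.1.factorial : ℝ) *
          Real.Gamma ((x.1 : ℝ) - 3 / 2) * Real.Gamma ((x.2 : ℝ) + 3 / 2))) *
      (2 * (k : ℝ) + 1) ^ (2 * x.2 + 1) * (8 * (n : ℝ) - (2 * (k : ℝ) + 1) ^ 2) ^ x.1

/-- The table of the constants `α_v` (only the listed arguments matter). -/
def tableAlpha : ℕ → ℚ
  | 2 => 1 / 64
  | 3 => 1 / 128
  | 4 => 15 / 4096
  | 5 => 7 / 4096
  | 6 => 105 / 131072
  | 7 => 99 / 262144
  | 8 => 3003 / 16777216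
  | 9 => 715 / 8388608
  | 10 => 21879 / 536870912
  | 11 => 20995 / 1073741824
  | 13 => 156009 / 34359738368
  | _ => 0

/-- The table of the constants `β_v` (only the listed arguments matter). -/
def tableBeta : ℕ → ℚ
  | 6 => -51051 / 22112
  | 8 => -9429849 / 1851904
  | 9 => -324385347 / 44919808
  | 10 => -328502311137 / 22886612992
  | 11 => -318771027861 / 10182066176
  | 13 => -162957690002835 / 1379781312512
  | _ => 0

/-- The `n`-th Fourier coefficient (in `q = e^{2πiz}`) of a cusp form for `SL₂(ℤ)`. -/
noncomputable def cuspCoeff {k : ℤ} (f : CuspForm 𝒮ℒ k) (n : ℕ) : ℂ :=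
  (UpperHalfPlane.qExpansion 1 f).coeff n

/-!
Write `J = ∏ (1 - qⁿ)³`, so that `η³ = q^{1/8} J` has weight `3/2`. By Jacobi,
`J = ∑ (-1)ᵏ (2k + 1) q^{T_k}`, while `1 / J = ∑ 𝔭₃(n) qⁿ` belongs to `η⁻³`, of weight `-3/2`.
The Rankin–Cohen bracket `[η⁻³, η³]_v`, a combination of the products of the `r`-th derivative of
`η⁻³` and the `s`-th derivative of `η³` with `r + s = v`, is a modular form of weight `2v` and level
one. In `q`-expansions, differentiation multiplies the `m`-th coefficient of `η⁻³` by `m - 1/8` and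
the `k`-th term of `η³` by `(2k + 1)² / 8`, so, suitably normalised, the bracket has `n`-th coefficient
`∑ₖ (-1)ᵏ 𝓔_v(n, k) 𝔭₃(n - T_k)`; this is `bracketSeries`. When there are no cusp forms of weight
`2v`, the bracket is a multiple of the Eisenstein series; when the cusp forms are spanned by
`Δ_{2v}`, it is a combination of the Eisenstein series and `Δ_{2v}`. Comparing the coefficients of
`q⁰` and `q¹` gives `α_v` and `β_v`, and solving for the term `k = 0` gives the recursion.

Forms of half-integral weight are avoided as follows. Put `y = E₂ / 12` and `h = D y - y²`, where
`D = q d/dq`; then `h` is a modular form of weight four (`thetaOp_qE2_mem_modularQExp`). A power `f`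
of `η` of weight `κ` satisfies `D f = κ y f`, so that `Dⁿ f / f` is a polynomial in the derivatives
of `y`. In generating function form, with each `Dⁿ f` divided by `n! κ (κ + 1) ⋯ (κ + n - 1)`, these
quotients are `exp (y T) ∑ pⱼ Tʲ`, where the `pⱼ` are given by a recursion in terms of the Serre
derivative and of `h`, and hence are modular forms of weight `2j` (`twistedSeq_succ`,
`serreSeq_mem_modularQExp`). In the bracket of `η⁻³` and `η³` the factors `exp (-y T)` and
`exp (y T)` cancel (`sum_twistedSeq_mul`), and so do `η⁻³` and `η³` themselves, which leaves a
polynomial in modular forms (`bracketSeries_mem_modularQExp`).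

The equation `D f = κ y f` for `η³` is an equation for the formal product `J`. That `J` is the series
`∑ (-1)ᵏ (2k + 1) q^{T_k}` comes from a finite identity, proved by induction (`sum_finiteTheta`), whose
terms stabilise modulo each power of `q`. A level one form of weight `2v` as considered here is
determined by its first two coefficients (`eq_zero_of_mem_modularQExp'`), by division by `Δ`.
Finally, `𝓔_v(n, 0)` is a polynomial in `8n - 1` with rational coefficients; after removal of
its content it has no zero modulo a small integer (`ratCalE_ne_zero`).
-/

section

open UpperHalfPlane hiding I
open Complex Function PowerSeries
open scoped Manifold ModularForm Real Topology

/-! ### `q`-expansions of functions regular at the cusp, and the Serre derivative -/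

/-- Functions on the upper half plane that are `1`-periodic, holomorphic, and bounded at `i∞`:
exactly those which are given by a power series in `q = e^{2πiz}`. -/
structure IsRegularAtCusp (F : ℍ → ℂ) : Prop where
  periodic : Periodic (F ∘ ofComplex) 1
  mdiff : MDiff F
  bdd : IsBoundedAtImInfty F

/-- The operator `q · d/dq` on power series in `q`. -/
noncomputable def thetaOp : Derivation ℂ ℂ⟦X⟧ ℂ⟦X⟧ := (X : ℂ⟦X⟧) • derivative ℂ

lemma coeff_thetaOp (p : ℂ⟦X⟧) (n : ℕ) : coeff n (thetaOp p) = n * coeff n p := by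
  rw [thetaOp, Derivation.smul_apply, smul_eq_mul]
  cases n with
  | zero => simp
  | succ n => rw [coeff_succ_X_mul, coeff_derivative]; push_cast; ring

namespace IsRegularAtCusp

variable {F G : ℍ → ℂ}

lemma analyticAt (hF : IsRegularAtCusp F) : AnalyticAt ℂ (cuspFunction 1 F) 0 :=
  analyticAt_cuspFunction_zero one_pos (by simpa using hF.periodic) hF.mdiff hF.bdd

lemma add (hF : IsRegularAtCusp F) (hG : IsRegularAtCusp G) : IsRegularAtCusp (F + G) where
  periodic := hF.periodic.add hG.periodic
  mdiff := hF.mdiff.add hG.mdiff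
  bdd := Filter.BoundedAtFilter.add hF.bdd hG.bdd

lemma mul (hF : IsRegularAtCusp F) (hG : IsRegularAtCusp G) : IsRegularAtCusp (F * G) where
  periodic := hF.periodic.mul hG.periodic
  mdiff := hF.mdiff.mul hG.mdiff
  bdd := Filter.BoundedAtFilter.mul hF.bdd hG.bdd

lemma smul (c : ℂ) (hF : IsRegularAtCusp F) : IsRegularAtCusp (c • F) where
  periodic := hF.periodic.smul c
  mdiff := hF.mdiff.const_smul c
  bdd := Filter.BoundedAtFilter.smul c hF.bdd

lemma qExpansion_add (hF : IsRegularAtCusp F) (hG : IsRegularAtCusp G) :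
    qExpansion 1 (F + G) = qExpansion 1 F + qExpansion 1 G :=
  UpperHalfPlane.qExpansion_add hF.analyticAt hG.analyticAt

lemma qExpansion_mul (hF : IsRegularAtCusp F) (hG : IsRegularAtCusp G) :
    qExpansion 1 (F * G) = qExpansion 1 F * qExpansion 1 G :=
  UpperHalfPlane.qExpansion_mul hF.analyticAt hG.analyticAt

lemma qExpansion_smul (c : ℂ) (hF : IsRegularAtCusp F) :
    qExpansion 1 (c • F) = c • qExpansion 1 F :=
  UpperHalfPlane.qExpansion_smul hF.analyticAt c

lemma hasSum_qExpansion (hF : IsRegularAtCusp F) (τ : ℍ) :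
    HasSum (fun m : ℕ ↦ (qExpansion 1 F).coeff m • Periodic.qParam 1 τ ^ m) (F τ) :=
  UpperHalfPlane.hasSum_qExpansion one_pos (by simpa using hF.periodic) hF.mdiff hF.bdd τ

lemma qExpansion_eq (hF : IsRegularAtCusp F) {p : ℂ⟦X⟧}
    (h : ∀ τ : ℍ, HasSum (fun m : ℕ ↦ p.coeff m • Periodic.qParam 1 τ ^ m) (F τ)) :
    qExpansion 1 F = p := by
  ext m
  have h1 := hasFPowerSeriesOnBall_cuspFunction one_pos hF.analyticAt h
  have h2 := hasFPowerSeriesOnBall_cuspFunction one_pos hF.analyticAt hF.hasSum_qExpansion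
  simpa using congr_arg (FormalMultilinearSeries.coeff · m)
    (h2.hasFPowerSeriesAt.eq_formalMultilinearSeries h1.hasFPowerSeriesAt)

open Derivative

lemma hasSum_normalizedDeriv (hF : IsRegularAtCusp F) (τ : ℍ) :
    HasSum (fun m : ℕ ↦ (thetaOp (qExpansion 1 F)).coeff m • Periodic.qParam 1 τ ^ m)
      (normalizedDerivOfComplex F τ) := by
  set Φ := cuspFunction 1 F
  set q := Periodic.qParam 1 (τ : ℂ) with hq
  have hper : Periodic (F ∘ ofComplex) (1 : ℝ) := by simpa using hF.periodic
  have hΦ : DifferentiableOn ℂ Φ (Metric.ball 0 1) :=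
    differentiableOn_cuspFunction_ball one_pos hper hF.mdiff hF.bdd
  have hqball : q ∈ Metric.ball (0 : ℂ) 1 := by
    simpa using Periodic.norm_qParam_lt_one one_pos τ.im_pos
  -- Near `τ`, `F` is the cusp function composed with the parameter `q`.
  have hcomp : (F ∘ ofComplex) =ᶠ[𝓝 (τ : ℂ)] Φ ∘ fun w ↦ Periodic.qParam 1 w :=
    .of_eq (funext fun w ↦ (Periodic.eq_cuspFunction one_ne_zero hper w).symm)
  have hdq : HasDerivAt (fun w : ℂ ↦ Periodic.qParam 1 w) (2 * π * I * q) (τ : ℂ) := by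
    have h1 : HasDerivAt (fun w : ℂ ↦ 2 * π * I * w / ((1 : ℝ) : ℂ)) (2 * π * I) (τ : ℂ) := by
      simpa using (hasDerivAt_id (τ : ℂ)).const_mul (2 * π * I)
    simpa [Periodic.qParam, hq, mul_comm] using h1.cexp
  have hdΦ : HasDerivAt Φ (deriv Φ q) q :=
    (hΦ.differentiableAt (Metric.isOpen_ball.mem_nhds hqball)).hasDerivAt
  have hD : normalizedDerivOfComplex F τ = q * deriv Φ q := by
    rw [normalizedDerivOfComplex, ((HasDerivAt.comp (τ : ℂ) hdΦ hdq).congr_of_eventuallyEq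
      hcomp).deriv]
    field_simp [two_pi_I_ne_zero]
  have hs := hasSum_taylorSeries_on_ball (hΦ.deriv Metric.isOpen_ball) hqball
  rw [hD, ← hasSum_nat_add_iff' 1]
  simp only [Finset.range_one, Finset.sum_singleton, coeff_thetaOp, Nat.cast_zero, zero_mul,
    zero_smul, sub_zero]
  convert! hs.mul_left q using 1
  ext m
  rw [qExpansion_coeff, ← iteratedDeriv_succ', Nat.factorial_succ]
  have : ((m : ℂ) + 1) ≠ 0 := by exact_mod_cast m.succ_ne_zero
  simp only [smul_eq_mul, sub_zero]
  push_cast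
  field_simp
  ring

lemma normalizedDeriv (hF : IsRegularAtCusp F) :
    IsRegularAtCusp (normalizedDerivOfComplex F) where
  periodic w := by
    by_cases! hw : 0 < w.im
    · have hw' : 0 < (w + 1).im := by simpa using hw
      simp only [comp_apply, normalizedDerivOfComplex, ofComplex_apply_of_im_pos hw,
        ofComplex_apply_of_im_pos hw']
      rw [← deriv_comp_add_const, show (fun x ↦ (F ∘ ofComplex) (x + 1)) = F ∘ ofComplex from
        funext hF.periodic]
    · have hw' : (w + 1).im ≤ 0 := by simpa using hw
      simp [ofComplex_apply_of_im_nonpos hw, ofComplex_apply_of_im_nonpos hw']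
  mdiff := normalizedDerivOfComplex_mdifferentiable hF.mdiff
  bdd := isBoundedAtImInfty_of_hasSum_qExpansion one_pos hF.hasSum_normalizedDeriv

lemma qExpansion_normalizedDeriv (hF : IsRegularAtCusp F) :
    qExpansion 1 (normalizedDerivOfComplex F) = thetaOp (qExpansion 1 F) :=
  hF.normalizedDeriv.qExpansion_eq hF.hasSum_normalizedDeriv

end IsRegularAtCusp

lemma isRegularAtCusp_modularForm {k : ℤ} (f : ModularForm 𝒮ℒ k) : IsRegularAtCusp f where
  periodic := by
    simpa using SlashInvariantFormClass.periodic_comp_ofComplex f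
      one_mem_strictPeriods_SL
  mdiff := f.holo'
  bdd := ModularFormClass.bdd_at_infty f

open EisensteinSeries

/-- The `q`-expansion `1 - 24 ∑ σ₁(n) qⁿ` of the weight two Eisenstein series. -/
noncomputable def qE2 : ℂ⟦X⟧ :=
  .mk fun m ↦ if m = 0 then 1 else -24 * (ArithmeticFunction.sigma 1 m : ℂ)

lemma isRegularAtCusp_E2 : IsRegularAtCusp E2 where
  periodic w := by
    by_cases! hw : 0 < w.im
    · have hw' : 0 < (w + 1).im := by simpa using hw
      simp only [comp_apply, ofComplex_apply_of_im_pos hw, ofComplex_apply_of_im_pos hw']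
      have h1 := hasSum_qExpansion_E2 (z := ⟨w, hw⟩)
      have h2 := hasSum_qExpansion_E2 (z := ⟨w + 1, hw'⟩)
      have h3 : cexp (2 * π * I * (w + 1)) = cexp (2 * π * I * w) := by
        rw [mul_add, mul_one, exp_add, exp_two_pi_mul_I, mul_one]
      simp only [h3] at h2
      exact h2.unique h1
    · have hw' : (w + 1).im ≤ 0 := by simpa using hw
      simp only [comp_apply, ofComplex_apply_of_im_nonpos hw, ofComplex_apply_of_im_nonpos hw']
  mdiff := E2_mdifferentiable
  bdd := isBoundedAtImInfty_E2

lemma qExpansion_E2 : qExpansion 1 E2 = qE2 :=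
  isRegularAtCusp_E2.qExpansion_eq fun τ ↦ by
    simpa [qE2, Periodic.qParam] using! hasSum_qExpansion_E2 (z := τ)

/-- The space of `q`-expansions of level one modular forms of weight `k`. -/
noncomputable def modularQExp (k : ℤ) : Submodule ℂ ℂ⟦X⟧ where
  carrier := {p | ∃ f : ModularForm 𝒮ℒ k, qExpansion 1 f = p}
  add_mem' := by
    rintro _ _ ⟨f, rfl⟩ ⟨g, rfl⟩
    exact ⟨f + g, ModularForm.qExpansion_add one_pos one_mem_strictPeriods_SL f g⟩
  zero_mem' := ⟨0, qExpansion_zero 1⟩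
  smul_mem' := by
    rintro c _ ⟨f, rfl⟩
    exact ⟨c • f, ModularForm.qExpansion_smul one_pos
      one_mem_strictPeriods_SL c f⟩

lemma one_mem_modularQExp : (1 : ℂ⟦X⟧) ∈ modularQExp 0 := ⟨1, ModularForm.qExpansion_one⟩

lemma mul_mem_modularQExp {a b : ℤ} {p r : ℂ⟦X⟧} (hp : p ∈ modularQExp a)
    (hr : r ∈ modularQExp b) : p * r ∈ modularQExp (a + b) := by
  obtain ⟨f, rfl⟩ := hp
  obtain ⟨g, rfl⟩ := hr
  exact ⟨f.mul g, ModularForm.qExpansion_mul one_pos one_mem_strictPeriods_SL f g⟩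

lemma IsRegularAtCusp.mem_modularQExp {F : ℍ → ℂ} (hF : IsRegularAtCusp F) {k : ℤ}
    (h : ∀ γ : SL(2, ℤ), F ∣[k] γ = F) : qExpansion 1 F ∈ modularQExp k := by
  refine ⟨{ toFun := F, slash_action_eq' := ?_, holo' := hF.mdiff, bdd_at_cusps' := ?_ }, rfl⟩
  · rintro _ ⟨γ, rfl⟩
    exact h γ
  · intro c hc
    rw [Subgroup.IsArithmetic.isCusp_iff_isCusp_SL2Z] at hc
    rw [OnePoint.isBoundedAt_iff_forall_SL2Z hc]
    intro γ _
    rw [h γ]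
    exact hF.bdd

/-- No modularity is needed here, so that the lemma applies to `E₂` as well. -/
lemma IsRegularAtCusp.serreDerivative {F : ℍ → ℂ} (hF : IsRegularAtCusp F) (k : ℂ) :
    IsRegularAtCusp (Derivative.serreDerivative k F) ∧
      qExpansion 1 (Derivative.serreDerivative k F) =
        thetaOp (qExpansion 1 F) - (k / 12) • (qE2 * qExpansion 1 F) := by
  have hEq : Derivative.serreDerivative k F =
      Derivative.normalizedDerivOfComplex F + (-(k / 12)) • (E2 * F) := by
    ext z
    simp [div_eq_mul_inv]
    ring
  have hEF := isRegularAtCusp_E2.mul hF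
  refine ⟨hEq ▸ hF.normalizedDeriv.add (hEF.smul _), ?_⟩
  rw [hEq, hF.normalizedDeriv.qExpansion_add (hEF.smul _), hEF.qExpansion_smul,
    isRegularAtCusp_E2.qExpansion_mul hF, hF.qExpansion_normalizedDeriv, qExpansion_E2]
  simp [sub_eq_add_neg]

/-- The Serre derivative maps modular forms of weight `k` to modular forms of weight `k + 2`. -/
lemma serreDerivative_mem_modularQExp {k : ℤ} {p : ℂ⟦X⟧} (hp : p ∈ modularQExp k) :
    thetaOp p - ((k : ℂ) / 12) • (qE2 * p) ∈ modularQExp (k + 2) := by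
  obtain ⟨f, rfl⟩ := hp
  obtain ⟨h1, h2⟩ := (isRegularAtCusp_modularForm f).serreDerivative k
  rw [← h2]
  refine h1.mem_modularQExp fun γ ↦ ?_
  exact Derivative.serreDerivative_slash_invariant f.holo' (f.slash_action_eq' _ ⟨γ, rfl⟩)

/-- `D E₂ - E₂² / 12` is a modular form of weight four: `E₂` and its derivative fail to be modular
in ways that cancel. -/
lemma thetaOp_qE2_mem_modularQExp :
    thetaOp qE2 - ((1 : ℂ) / 12) • (qE2 * qE2) ∈ modularQExp 4 := by
  obtain ⟨h1, h2⟩ := isRegularAtCusp_E2.serreDerivative 1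
  rw [qExpansion_E2] at h2
  rw [← h2]
  refine h1.mem_modularQExp fun γ ↦ ?_
  set φ : ℍ → ℂ := E2 ∣[(2 : ℤ)] γ - E2 with hφ
  have hE2γ : E2 ∣[(2 : ℤ)] γ = E2 + φ := by simp [hφ]
  have hφval (z : ℍ) : φ z = 12 * (2 * π * I)⁻¹ * (γ 1 0 : ℂ) * (denom γ z)⁻¹ := by
    have hπ : (π : ℂ) ≠ 0 := by exact_mod_cast Real.pi_ne_zero
    have hd := denom_ne_zero γ z
    have hI := I_sq
    simp only [hφ, E2_slash_action, Pi.sub_apply, Pi.smul_apply, D2, riemannZeta_two, smul_eq_mul]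
    field_simp
    linear_combination (-12 * (γ 1 0 : ℂ)) * hI
  have hφdiff : MDiff φ := by
    rw [hφ]
    exact ((E2_mdifferentiable).slash _ _).sub E2_mdifferentiable
  -- The derivative of the cocycle `φ` is `-φ² / 12`.
  have hDφ : Derivative.normalizedDerivOfComplex φ = (-(1 : ℂ) / 12) • (φ * φ) := by
    ext z
    have hd := denom_ne_zero γ z
    have h1 : HasDerivAt (fun w : ℂ ↦ (denom γ w) ^ (-1 : ℤ)) (-1 * (γ 1 0 : ℂ) *
        (denom γ z) ^ (-1 - 1 : ℤ)) (z : ℂ) := by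
      simpa using hasDerivAt_denom_zpow γ (-1) z
    have h2 : (φ ∘ ofComplex) =ᶠ[𝓝 (z : ℂ)]
        fun w ↦ (12 * (2 * π * I)⁻¹ * (γ 1 0 : ℂ)) * (denom γ w) ^ (-1 : ℤ) := by
      filter_upwards [isOpen_upperHalfPlaneSet.mem_nhds z.im_pos] with w hw
      rw [comp_apply, hφval, ofComplex_apply_of_im_pos hw]
      simp
    rw [Derivative.normalizedDerivOfComplex, ((h1.const_mul _).congr_of_eventuallyEq h2).deriv]
    simp only [Pi.smul_apply, Pi.mul_apply, hφval, smul_eq_mul]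
    rw [show (-1 - 1 : ℤ) = -2 by norm_num, zpow_neg]
    field_simp
  have hsum : Derivative.serreDerivative 1 E2 =
      Derivative.serreDerivative ((2 : ℤ) : ℂ) E2 + ((1 : ℂ) / 12) • (E2 * E2) := by
    ext z
    simp
    ring
  have e1 := Derivative.serreDerivative_slash_equivariant (k := 2) E2_mdifferentiable (γ := γ)
  have e2 := ModularForm.mul_slash_SL2 2 2 γ E2 E2
  rw [hsum, SlashAction.add_slash, ModularForm.SL_smul_slash, show (4 : ℤ) = 2 + 2 by norm_num,
    e1, e2, hE2γ, Derivative.serreDerivative_add _ _ _ E2_mdifferentiable hφdiff]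
  ext z
  have := congrFun hDφ z
  simp only [Pi.add_apply, Pi.mul_apply, Pi.smul_apply, smul_eq_mul,
    Derivative.serreDerivative_apply] at this ⊢
  rw [this]
  push_cast
  ring

/-! ### Iterated derivatives and the modularity of Rankin–Cohen brackets -/

section RankinCohen

open Finset HasAntidiagonal

/-- A sequence shifted by one place, starting with `0`. -/
def shiftSeq {R : Type*} [CommRing R] (f : ℕ → R) : ℕ → R
  | 0 => 0
  | n + 1 => f n

lemma sum_mul_shiftSeq {R : Type*} [CommRing R] (f g : ℕ → R) (n : ℕ) :
    ∑ x ∈ antidiagonal n, f x.1 * shiftSeq g x.2 =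
      ∑ x ∈ antidiagonal n, shiftSeq f x.1 * g x.2 := by
  cases n with
  | zero => simp [shiftSeq]
  | succ n => rw [Nat.sum_antidiagonal_succ', Nat.sum_antidiagonal_succ]; simp [shiftSeq]

variable {R : Type*} [CommRing R] [Algebra ℂ R] (θ : Derivation ℂ R R) (y h : R) (κ : ℂ)

/-- The sequence `pⱼ` with `p₀ = 1`, `p₁ = 0` and
`(j + 1)(κ + j) pⱼ₊₁ = θ pⱼ - 2 j y pⱼ + h pⱼ₋₁`. When `y = E₂ / 12`, the operator `θ - 2 j y` is the
Serre derivative in weight `2j`, the weight of `pⱼ`. -/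
noncomputable def serreSeq : ℕ → R
  | 0 => 1
  | 1 => 0
  | n + 2 => (((n : ℂ) + 2) * (κ + (n + 1 : ℕ)))⁻¹ •
      (θ (serreSeq (n + 1)) - (2 * (n + 1 : ℕ) : ℂ) • (y * serreSeq (n + 1)) + h * serreSeq n)

/-- The divided powers `yⁱ / i!`. -/
noncomputable def divPow (i : ℕ) : R := ((i.factorial : ℂ)⁻¹) • y ^ i

/-- The Cauchy product of the exponential series in `y` with `serreSeq`. -/
noncomputable def twistedSeq (n : ℕ) : R :=
  ∑ x ∈ antidiagonal n, divPow y x.1 * serreSeq θ y h κ x.2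

variable {θ y h κ}

lemma serreSeq_succ (hκ : ∀ n : ℕ, κ + n ≠ 0) (j : ℕ) :
    (((j : ℂ) + 1) * (κ + j)) • serreSeq θ y h κ (j + 1) =
      θ (serreSeq θ y h κ j) - (2 * j : ℂ) • (y * serreSeq θ y h κ j)
        + h * shiftSeq (serreSeq θ y h κ) j := by
  cases j with
  | zero => simp [serreSeq, shiftSeq]
  | succ j =>
    have h1 : ((j : ℂ) + 2) ≠ 0 := by exact_mod_cast (j + 1).succ_ne_zero
    rw [serreSeq, smul_smul, shiftSeq]
    rw [show (((j + 1 : ℕ) : ℂ) + 1) = (j : ℂ) + 2 by push_cast; ring,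
      mul_inv_cancel₀ (mul_ne_zero h1 (hκ (j + 1))), one_smul]

lemma succ_smul_divPow (i : ℕ) : ((i : ℂ) + 1) • divPow y (i + 1) = y * divPow y i := by
  have h1 : ((i : ℂ) + 1) ≠ 0 := by exact_mod_cast i.succ_ne_zero
  rw [divPow, divPow, smul_smul, Nat.factorial_succ, mul_smul_comm, ← pow_succ']
  congr 1
  push_cast
  field_simp

lemma mul_shiftSeq_divPow (i : ℕ) : y * shiftSeq (divPow y) i = (i : ℂ) • divPow y i := by
  cases i with
  | zero => simp [shiftSeq]
  | succ i => simp [shiftSeq, ← succ_smul_divPow]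

lemma derivation_divPow (hy : θ y = y ^ 2 + h) (i : ℕ) :
    θ (divPow y i) = (i : ℂ) • (y * divPow y i) + h * shiftSeq (divPow y) i := by
  have key : θ (divPow y i) = shiftSeq (divPow y) i * θ y := by
    cases i with
    | zero => simp [divPow, shiftSeq]
    | succ i =>
      have h1 : ((i : ℂ) + 1) ≠ 0 := by exact_mod_cast i.succ_ne_zero
      rw [divPow, Derivation.map_smul, Derivation.leibniz_pow, shiftSeq, divPow, Nat.factorial_succ,
        Nat.add_sub_cancel, smul_eq_mul, ← Nat.cast_smul_eq_nsmul ℂ, smul_smul, smul_mul_assoc]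
      congr 1
      push_cast
      field_simp
  rw [key, hy, ← mul_smul_comm, ← mul_shiftSeq_divPow]
  ring

/-- The recursion characterising iterated derivatives: in generating function form, twisting by
`exp (yT)` turns the Serre-type recursion of `serreSeq` into iteration of `θ + κ y`. -/
lemma twistedSeq_succ (hκ : ∀ n : ℕ, κ + n ≠ 0) (hy : θ y = y ^ 2 + h) (n : ℕ) :
    (((n : ℂ) + 1) * (κ + n)) • twistedSeq θ y h κ (n + 1) =
      θ (twistedSeq θ y h κ n) + κ • (y * twistedSeq θ y h κ n) := by
  set e := divPow y with he
  set p := serreSeq θ y h κ with hp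
  -- For `i + j = n + 1`, the factor splits as `i (i - 1) + i (2 j + κ) + j (j - 1 + κ)`.
  have hsplit : (((n : ℂ) + 1) * (κ + n)) • twistedSeq θ y h κ (n + 1) =
      ∑ x ∈ antidiagonal (n + 1), ((x.1 : ℂ) * (x.1 - 1 + (2 * x.2 + κ))) • (e x.1 * p x.2)
        + ∑ x ∈ antidiagonal (n + 1), ((x.2 : ℂ) * (x.2 - 1 + κ)) • (e x.1 * p x.2) := by
    rw [twistedSeq, smul_sum, ← sum_add_distrib]
    refine sum_congr rfl fun x hx ↦ ?_
    have hx' : (x.1 : ℂ) + x.2 = n + 1 := by exact_mod_cast mem_antidiagonal.mp hx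
    rw [← add_smul, show (n : ℂ) = x.1 + x.2 - 1 by rw [hx']; ring]
    congr 1
    ring
  have h1 : ∑ x ∈ antidiagonal (n + 1), ((x.1 : ℂ) * (x.1 - 1 + (2 * x.2 + κ))) • (e x.1 * p x.2) =
      ∑ x ∈ antidiagonal n, ((x.1 : ℂ) + 2 * x.2 + κ) • (y * (e x.1 * p x.2)) := by
    rw [Nat.sum_antidiagonal_succ]
    simp only [Nat.cast_zero, zero_mul, zero_smul, zero_add]
    refine sum_congr rfl fun x _ ↦ ?_
    rw [← mul_assoc, ← succ_smul_divPow, smul_mul_assoc, smul_smul]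
    congr 1
    push_cast
    ring
  have h2 : ∑ x ∈ antidiagonal (n + 1), ((x.2 : ℂ) * (x.2 - 1 + κ)) • (e x.1 * p x.2) =
      ∑ x ∈ antidiagonal n, e x.1 * (θ (p x.2) - (2 * x.2 : ℂ) • (y * p x.2)
        + h * shiftSeq p x.2) := by
    rw [Nat.sum_antidiagonal_succ']
    simp only [Nat.cast_zero, zero_mul, zero_smul, zero_add]
    refine sum_congr rfl fun x _ ↦ ?_
    rw [← serreSeq_succ hκ, mul_smul_comm]
    congr 1
    push_cast
    ring
  have h3 := sum_mul_shiftSeq e p n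
  rw [hsplit, h1, h2, twistedSeq, map_sum, mul_sum, smul_sum, ← sum_add_distrib,
    ← sum_add_distrib, ← sub_eq_zero, ← sum_sub_distrib]
  calc _ = ∑ x ∈ antidiagonal n, h * (e x.1 * shiftSeq p x.2 - shiftSeq e x.1 * p x.2) := by
        refine sum_congr rfl fun x _ ↦ ?_
        rw [Derivation.leibniz, derivation_divPow hy]
        simp only [smul_eq_mul, Algebra.smul_def, map_add, map_mul, map_natCast, map_ofNat]
        ring
    _ = 0 := by rw [← mul_sum, sum_sub_distrib, h3, sub_self, mul_zero]

/-- In the alternating convolution of two twisted sequences the exponential factors cancel. -/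
lemma sum_twistedSeq_mul (κ₁ κ₂ : ℂ) (n : ℕ) :
    ∑ x ∈ antidiagonal n, (-1) ^ x.1 * (twistedSeq θ y h κ₁ x.1 * twistedSeq θ y h κ₂ x.2) =
      ∑ x ∈ antidiagonal n, (-1) ^ x.1 * (serreSeq θ y h κ₁ x.1 * serreSeq θ y h κ₂ x.2) := by
  set e : R⟦X⟧ := .mk (divPow y)
  have hmk (κ : ℂ) : (.mk (twistedSeq θ y h κ) : R⟦X⟧) = e * .mk (serreSeq θ y h κ) := by
    ext n
    simp [e, coeff_mul, twistedSeq]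
  have he : e = rescale y (map (algebraMap ℂ R) (exp ℂ)) := by
    ext n
    simp [e, divPow, coeff_exp, Algebra.smul_def, mul_comm]
  have hee : evalNegHom e * e = 1 := by
    have h1 := congrArg (rescale y) (congrArg (map (algebraMap ℂ R))
      (exp_mul_exp_neg_eq_one (A := ℂ)))
    rw [he]
    simp only [map_mul, map_one] at h1
    rw [mul_comm, ← h1]
    congr 1
    ext n
    simp [evalNegHom, coeff_rescale]
    ring
  have hc (a b : R⟦X⟧) : ∑ x ∈ antidiagonal n, (-1) ^ x.1 * (coeff x.1 a * coeff x.2 b) =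
      coeff n (evalNegHom a * b) := by
    rw [coeff_mul]
    refine sum_congr rfl fun x _ ↦ ?_
    rw [evalNegHom, coeff_rescale]
    ring
  have h1 := hc (.mk (twistedSeq θ y h κ₁)) (.mk (twistedSeq θ y h κ₂))
  have h2 := hc (.mk (serreSeq θ y h κ₁)) (.mk (serreSeq θ y h κ₂))
  simp only [coeff_mk] at h1 h2
  rw [h1, h2, hmk, hmk, _root_.map_mul evalNegHom, mul_mul_mul_comm, hee, one_mul]

end RankinCohen

/-- `E₂ / 12`, as a power series in `q`. -/
noncomputable def qY : ℂ⟦X⟧ := (12 : ℂ)⁻¹ • qE2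

/-- The weight four form `(D E₂ - E₂² / 12) / 12`, as a power series in `q`. -/
noncomputable def qH : ℂ⟦X⟧ := thetaOp qY - qY ^ 2

lemma thetaOp_qY : thetaOp qY = qY ^ 2 + qH := by simp [qH]

lemma qH_mem_modularQExp : qH ∈ modularQExp 4 := by
  have h := (modularQExp 4).smul_mem (12 : ℂ)⁻¹ thetaOp_qE2_mem_modularQExp
  convert h using 1
  simp only [qH, qY, Derivation.map_smul, smul_sub, smul_smul, pow_two, smul_mul_smul_comm]
  norm_num

lemma serreSeq_mem_modularQExp (κ : ℂ) (n : ℕ) :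
    serreSeq thetaOp qY qH κ n ∈ modularQExp (2 * n) := by
  induction n using Nat.twoStepInduction with
  | zero => exact one_mem_modularQExp
  | one => exact Submodule.zero_mem _
  | more n ih₀ ih₁ =>
    rw [serreSeq]
    refine Submodule.smul_mem _ _ (Submodule.add_mem _ ?_ ?_)
    · have := serreDerivative_mem_modularQExp ih₁
      convert this using 2
      · push_cast; ring
      · rw [qY, smul_mul_assoc, smul_smul]
        congr 1
        push_cast
        ring
    · have := mul_mem_modularQExp qH_mem_modularQExp ih₀
      convert this using 2
      push_cast; ring

/-- If `f` satisfies the differential equation of a power of `η` of weight `κ`, the coefficients of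
`twistedSeq n * f` are those of the normalised `n`-th derivative of `q ^ (κ / 12) f`. -/
lemma coeff_twistedSeq_mul {κ : ℂ} (hκ : ∀ n : ℕ, κ + n ≠ 0) {f : ℂ⟦X⟧}
    (hf : thetaOp f + (κ / 12) • f = κ • (qY * f)) (n m : ℕ) :
    coeff m (twistedSeq thetaOp qY qH κ n * f) =
      ((m : ℂ) + κ / 12) ^ n / (n.factorial * (ascPochhammer ℂ n).eval κ) * coeff m f := by
  induction n generalizing m with
  | zero => simp [twistedSeq, divPow, serreSeq]
  | succ n ih =>
    have h1 : ((n : ℂ) + 1) ≠ 0 := by exact_mod_cast n.succ_ne_zero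
    have h2 := hκ n
    have hrec : (((n : ℂ) + 1) * (κ + n)) • (twistedSeq thetaOp qY qH κ (n + 1) * f) =
        thetaOp (twistedSeq thetaOp qY qH κ n * f)
          + (κ / 12) • (twistedSeq thetaOp qY qH κ n * f) := by
      rw [← smul_mul_assoc, twistedSeq_succ hκ thetaOp_qY, Derivation.leibniz]
      have := congrArg (twistedSeq thetaOp qY qH κ n * ·) hf
      simp only [mul_add, mul_smul_comm] at this
      rw [add_mul, add_right_comm, smul_eq_mul, smul_eq_mul, this, add_comm, smul_mul_assoc]
      rw [mul_comm f, mul_assoc, mul_left_comm]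
    have hc := congrArg (coeff m) hrec
    rw [map_add, coeff_smul, coeff_smul, coeff_thetaOp, ih] at hc
    rw [ascPochhammer_succ_eval, Nat.factorial_succ, pow_succ]
    have h3 : coeff m (twistedSeq thetaOp qY qH κ (n + 1) * f) =
      (((n : ℂ) + 1) * (κ + n))⁻¹ * ((((n : ℂ) + 1) * (κ + n)) •
        coeff m (twistedSeq thetaOp qY qH κ (n + 1) * f)) := by
      rw [smul_eq_mul, inv_mul_cancel_left₀ (mul_ne_zero h1 h2)]
    rw [h3, hc]
    push_cast
    simp only [smul_eq_mul, div_eq_mul_inv, mul_inv]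
    ring

/-! ### The finite form of Jacobi's identity -/

section Jacobi

open Finset

/-- The finite product `(1 - q)(1 - q²) ⋯ (1 - qᵐ)`. -/
noncomputable def qPoch (m : ℕ) : ℂ⟦X⟧ := ∏ i ∈ range m, (1 - X ^ (i + 1))

lemma qPoch_succ (m : ℕ) : qPoch (m + 1) = qPoch m * (1 - X ^ (m + 1)) := prod_range_succ _ _

lemma constantCoeff_qPoch (m : ℕ) : constantCoeff (qPoch m) = 1 := by
  simp [qPoch, map_prod]

lemma qPoch_ne_zero (m : ℕ) : constantCoeff (qPoch m) ≠ 0 := by simp [constantCoeff_qPoch]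

lemma inv_qPoch (m : ℕ) : (qPoch m)⁻¹ = (1 - X ^ (m + 1)) * (qPoch (m + 1))⁻¹ := by
  rw [eq_comm, PowerSeries.eq_inv_iff_mul_eq_one (qPoch_ne_zero m)]
  have := PowerSeries.mul_inv_cancel _ (qPoch_ne_zero (m + 1))
  rw [qPoch_succ] at this ⊢
  linear_combination this

lemma triangular_succ (k : ℕ) : triangular (k + 1) = triangular k + (k + 1) := by
  rw [triangular, triangular, show (k + 1) ^ 2 + (k + 1) = k ^ 2 + k + (k + 1) * 2 by ring,
    Nat.add_mul_div_right _ _ two_pos]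

lemma le_triangular (k : ℕ) : k ≤ triangular k := by
  induction k with
  | zero => simp
  | succ k ih => rw [triangular_succ]; omega

/-- `1 / (q)_{n - k}`, understood as `0` when `k > n`. -/
noncomputable def invPochSub (n k : ℕ) : ℂ⟦X⟧ := if k ≤ n then (qPoch (n - k))⁻¹ else 0

/-- The coefficients `(-1)ᵏ q^{k(k+1)/2} / ((q)_{n-k} (q)_{n+k+1})` of the finite form of the
triple product identity. -/
noncomputable def finiteTheta (n k : ℕ) : ℂ⟦X⟧ :=
  (-1) ^ k * X ^ triangular k * (invPochSub n k * (qPoch (n + k + 1))⁻¹)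

lemma finiteTheta_of_lt {n k : ℕ} (h : n < k) : finiteTheta n k = 0 := by
  simp [finiteTheta, invPochSub, h.not_ge]

lemma invPochSub_of_add {n k a : ℕ} (h : n + 1 = a + k) :
    invPochSub n k = (1 - X ^ a) * (qPoch a)⁻¹ := by
  rw [invPochSub]
  split_ifs with hk
  · obtain ⟨b, rfl⟩ : ∃ b, a = b + 1 := ⟨n - k, by omega⟩
    rw [show n - k = b by omega, inv_qPoch]
  · obtain rfl : a = 0 := by omega
    simp

lemma X_mul_invPochSub_succ {n k a : ℕ} (h : n + 1 = a + k) :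
    X * invPochSub n (k + 1) = (X - X ^ a) * ((1 - X ^ a) * (qPoch a)⁻¹) := by
  obtain _ | b := a
  · rw [invPochSub, if_neg (by omega)]; simp
  · rw [invPochSub_of_add (a := b) (by omega), inv_qPoch]
    ring

/-- The step `n → n + 1` in the finite triple product identity, away from the axis of symmetry:
multiplication by `(1 - x q^{n+1})(1 - x⁻¹ q^{n+1})`, read off on the coefficient of `x^{k+1}`. -/
lemma finiteTheta_succ_succ {n k : ℕ} (hk : k ≤ n) :
    (1 - X ^ (2 * n + 2)) * (1 - X ^ (2 * n + 3)) * finiteTheta (n + 1) (k + 1) =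
      (1 + X ^ (2 * n + 2)) * finiteTheta n (k + 1)
        - X ^ (n + 1) * (finiteTheta n k + finiteTheta n (k + 2)) := by
  obtain ⟨a, rfl⟩ := Nat.exists_eq_add_of_le' hk
  have e1 := X_mul_invPochSub_succ (n := a + k) (k := k + 1) (a := a) (by omega)
  have e2 : invPochSub (a + k + 1) (k + 1) = (qPoch a)⁻¹ := by
    rw [invPochSub, if_pos (by omega), show a + k + 1 - (k + 1) = a by omega]
  have e3 : invPochSub (a + k) k = (qPoch a)⁻¹ := by
    rw [invPochSub, if_pos (by omega), Nat.add_sub_cancel]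
  simp only [finiteTheta, triangular_succ]
  rw [e2, e3, invPochSub_of_add (n := a + k) (k := k + 1) (a := a) (by omega),
    show a + k + (k + 1) + 1 = a + k + k + 2 by ring,
    show a + k + 1 + (k + 1) + 1 = a + k + k + 3 by ring,
    show a + k + (k + 2) + 1 = a + k + k + 3 by ring,
    inv_qPoch (a + k + k + 1), inv_qPoch (a + k + k + 2)]
  linear_combination ((-1) ^ k * X ^ (triangular k + 2 * k + 2 + (a + k) + 1) *
    (qPoch (a + k + k + 3))⁻¹) * e1

lemma finiteTheta_succ_zero (n : ℕ) :
    (1 - X ^ (2 * n + 2)) * (1 - X ^ (2 * n + 3)) * finiteTheta (n + 1) 0 =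
      (1 + X ^ (2 * n + 2)) * finiteTheta n 0
        - X ^ (n + 1) * (finiteTheta n 1 - finiteTheta n 0) := by
  have e1 := X_mul_invPochSub_succ (n := n) (k := 0) (a := n + 1) (by omega)
  have e2 : invPochSub (n + 1) 0 = (qPoch (n + 1))⁻¹ := by simp [invPochSub]
  simp only [finiteTheta]
  rw [e2, invPochSub_of_add (n := n) (k := 0) (a := n + 1) (by omega),
    show triangular 1 = 1 by rfl, show triangular 0 = 0 by rfl, add_zero, add_zero,
    inv_qPoch (n + 1)]
  rw [inv_qPoch (n + 1)] at e1
  linear_combination (-X ^ (n + 1) * (qPoch (n + 1 + 1))⁻¹) * e1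

lemma sum_odd_mul_neighbours {R : Type*} [CommRing R] (f : ℕ → R) (N : ℕ) :
    f 1 - f 0 + ∑ k ∈ range N, (2 * (k + 1 : ℕ) + 1 : R) * (f k + f (k + 2)) =
      2 * ∑ k ∈ range N, (2 * k + 1 : R) * f k + (2 * N - 1) * f N + (2 * N + 1) * f (N + 1) := by
  induction N with
  | zero => simp; ring
  | succ N ih =>
    rw [sum_range_succ, ← add_assoc, ih, sum_range_succ]
    push_cast
    ring

/-- The finite form of Jacobi's identity for `∏ (1 - qⁿ)³`. -/
lemma sum_finiteTheta (n : ℕ) :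
    (∑ k ∈ range (n + 1), (2 * k + 1 : ℂ⟦X⟧) * finiteTheta n k) * qPoch (2 * n + 1) =
      qPoch n ^ 2 := by
  induction n with
  | zero =>
    have := PowerSeries.mul_inv_cancel _ (qPoch_ne_zero 1)
    have h0 : qPoch 0 = 1 := by simp [qPoch]
    simp only [finiteTheta, invPochSub, triangular, h0]
    simpa [mul_comm, h0] using this
  | succ n ih =>
    have h0 : finiteTheta n (n + 1) = 0 := finiteTheta_of_lt (by omega)
    have h1 : finiteTheta n (n + 2) = 0 := finiteTheta_of_lt (by omega)
    have hsum : (1 - X ^ (2 * n + 2)) * (1 - X ^ (2 * n + 3)) *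
        (∑ k ∈ range (n + 2), (2 * k + 1 : ℂ⟦X⟧) * finiteTheta (n + 1) k) =
        (1 - X ^ (n + 1)) ^ 2 * ∑ k ∈ range (n + 1), (2 * k + 1 : ℂ⟦X⟧) * finiteTheta n k := by
      have hn := sum_odd_mul_neighbours (finiteTheta n) (n + 1)
      rw [h0, h1] at hn
      have e1 : ∑ k ∈ range (n + 1), (2 * k + 1 : ℂ⟦X⟧) * finiteTheta n k =
          finiteTheta n 0 + ∑ k ∈ range (n + 1), (2 * (k + 1 : ℕ) + 1 : ℂ⟦X⟧) *
            finiteTheta n (k + 1) := by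
        have := sum_range_succ' (fun k ↦ (2 * k + 1 : ℂ⟦X⟧) * finiteTheta n k) (n + 1)
        rw [sum_range_succ, h0] at this
        simpa [add_comm] using this
      have e2 : (1 - X ^ (2 * n + 2)) * (1 - X ^ (2 * n + 3)) *
          (∑ k ∈ range (n + 1), (2 * (k + 1 : ℕ) + 1 : ℂ⟦X⟧) * finiteTheta (n + 1) (k + 1)) =
          ∑ k ∈ range (n + 1), ((1 + X ^ (2 * n + 2)) *
            ((2 * (k + 1 : ℕ) + 1 : ℂ⟦X⟧) * finiteTheta n (k + 1))
            - X ^ (n + 1) * ((2 * (k + 1 : ℕ) + 1 : ℂ⟦X⟧) *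
              (finiteTheta n k + finiteTheta n (k + 2)))) := by
        rw [mul_sum]
        refine sum_congr rfl fun k hk ↦ ?_
        have := finiteTheta_succ_succ (n := n) (k := k) (by have := mem_range.mp hk; omega)
        linear_combination (2 * (k + 1 : ℕ) + 1 : ℂ⟦X⟧) * this
      rw [sum_sub_distrib, ← mul_sum, ← mul_sum] at e2
      rw [sum_range_succ', mul_add, e2]
      have e3 := finiteTheta_succ_zero n
      simp only [Nat.cast_zero, mul_zero, zero_add, one_mul, add_zero] at hn e1 ⊢
      linear_combination e3 - X ^ (n + 1) * hn - (1 + X ^ (2 * n + 2)) * e1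
    rw [show 2 * (n + 1) + 1 = 2 * n + 1 + 1 + 1 by ring, qPoch_succ (2 * n + 1 + 1),
      qPoch_succ (2 * n + 1), qPoch_succ n]
    linear_combination qPoch (2 * n + 1) * hsum + (1 - X ^ (n + 1)) ^ 2 * ih

end Jacobi

/-! ### Jacobi's identity and the differential equation of `η³` -/

section EtaCubed

open Finset

/-- The series `∑ (-1)ᵏ (2k + 1) q^{k(k+1)/2}`. -/
noncomputable def jacobiSeries : ℂ⟦X⟧ :=
  .mk fun n ↦ ∑ k ∈ range (n + 1), if triangular k = n then (-1) ^ k * (2 * k + 1 : ℂ) else 0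

/-- The products `qPoch m` with `m ≥ N` all agree modulo `q ^ (N + 1)`. -/
lemma X_pow_dvd_qPoch_sub {N m : ℕ} (h : N ≤ m) : (X : ℂ⟦X⟧) ^ (N + 1) ∣ qPoch m - qPoch N := by
  induction m, h using Nat.le_induction with
  | base => simp
  | succ m hm ih =>
    rw [show qPoch (m + 1) - qPoch N = (qPoch m - qPoch N) - X ^ (m + 1) * qPoch m by
      rw [qPoch_succ]; ring]
    exact dvd_sub ih ((pow_dvd_pow _ (by omega)).mul_right _)

lemma X_pow_dvd_jacobiSeries_sub_sum {N M : ℕ} (h : N < M) : (X : ℂ⟦X⟧) ^ (N + 1) ∣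
    jacobiSeries - ∑ k ∈ range M, (2 * k + 1 : ℂ⟦X⟧) * ((-1) ^ k * X ^ triangular k) := by
  rw [X_pow_dvd_iff]
  intro m hm
  have hcoeff (k : ℕ) : coeff m ((2 * k + 1 : ℂ⟦X⟧) * ((-1) ^ k * X ^ triangular k)) =
      if triangular k = m then (-1) ^ k * (2 * k + 1 : ℂ) else 0 := by
    rw [show (2 * k + 1 : ℂ⟦X⟧) * ((-1) ^ k * X ^ triangular k) =
      C ((-1) ^ k * (2 * k + 1 : ℂ)) * X ^ triangular k by
        simp [show (C (2 : ℂ) : ℂ⟦X⟧) = 2 from map_ofNat C 2]; ring, coeff_C_mul_X_pow]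
    simp [eq_comm]
  rw [map_sub, map_sum, jacobiSeries, coeff_mk, sub_eq_zero, sum_congr rfl fun k _ ↦ hcoeff k]
  refine sum_subset (range_mono (by omega)) fun k _ hk ↦ if_neg fun h ↦ hk ?_
  have := le_triangular k
  simp; omega

/-- Jacobi's identity `∑ (-1)ᵏ (2k + 1) q^{k(k+1)/2} = ∏ (1 - qⁿ)³`, modulo `q ^ (N + 1)`. -/
lemma X_pow_dvd_jacobiSeries_sub (N : ℕ) :
    (X : ℂ⟦X⟧) ^ (N + 1) ∣ jacobiSeries - qPoch N ^ 3 := by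
  set I : Ideal ℂ⟦X⟧ := Ideal.span {(X : ℂ⟦X⟧) ^ (N + 1)} with hI
  set φ := Ideal.Quotient.mk I
  have hφ {a b : ℂ⟦X⟧} : φ a = φ b ↔ (X : ℂ⟦X⟧) ^ (N + 1) ∣ a - b := by
    rw [Ideal.Quotient.mk_eq_mk_iff_sub_mem, hI, Ideal.mem_span_singleton]
  have hP {m : ℕ} (h : N ≤ m) : φ (qPoch m) = φ (qPoch N) := hφ.mpr (X_pow_dvd_qPoch_sub h)
  have hinv (m : ℕ) : φ (qPoch m) * φ (qPoch m)⁻¹ = 1 := by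
    rw [← map_mul, PowerSeries.mul_inv_cancel _ (qPoch_ne_zero m), map_one]
  -- In `finiteTheta (2 * N) k` with `k ≤ N`, both indices `2N - k` and `2N + k + 1` are at least `N`,
  -- so both `q`-products agree with `qPoch N`; for `k > N` both sides vanish as `T_k > N`.
  have hterm (k : ℕ) : φ (finiteTheta (2 * N) k) * φ (qPoch N) ^ 2 =
      φ ((-1) ^ k * X ^ triangular k) := by
    by_cases hk : k ≤ N
    · rw [finiteTheta, invPochSub, if_pos (by omega), map_mul φ (_ * _), map_mul φ (_⁻¹)]
      have h1 := hinv (2 * N - k)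
      have h2 := hinv (2 * N + k + 1)
      rw [hP (by omega)] at h1 h2
      linear_combination (φ ((-1) ^ k * X ^ triangular k)) *
        (φ (qPoch N) * φ (qPoch (2 * N - k))⁻¹ * h2 + h1)
    · have h0 : φ (X ^ triangular k) = 0 := by
        rw [← map_zero φ, hφ, sub_zero]
        exact pow_dvd_pow _ (by have := le_triangular k; omega)
      rw [finiteTheta, map_mul, map_mul, map_mul, h0]
      ring
  have hfin := congrArg φ (sum_finiteTheta (2 * N))
  rw [map_mul, map_pow, hP (by omega : N ≤ 2 * (2 * N) + 1), hP (by omega : N ≤ 2 * N)] at hfin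
  have hJ := hφ.mpr (X_pow_dvd_jacobiSeries_sub_sum (N := N) (M := 2 * N + 1) (by omega))
  have hJ' : φ jacobiSeries =
      φ (∑ k ∈ range (2 * N + 1), (2 * k + 1 : ℂ⟦X⟧) * finiteTheta (2 * N) k) *
        φ (qPoch N) ^ 2 := by
    rw [hJ, map_sum, map_sum, sum_mul]
    refine sum_congr rfl fun k _ ↦ ?_
    rw [map_mul φ (_ + _), map_mul φ (_ + _), ← hterm]
    ring
  rw [← hφ, hJ', map_pow]
  linear_combination (φ (qPoch N)) * hfin

/-- The Lambert series `∑ₘ i q^{im}`, the logarithmic derivative of `1 / (1 - qⁱ)`. -/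
noncomputable def lambertTerm (i : ℕ) : ℂ⟦X⟧ :=
  .mk fun n ↦ if n ≠ 0 ∧ i ∣ n then (i : ℂ) else 0

lemma one_sub_mul_lambertTerm {i : ℕ} (hi : i ≠ 0) :
    (1 - X ^ i) * lambertTerm i = (i : ℂ⟦X⟧) * X ^ i := by
  ext n
  rw [sub_mul, one_mul, map_sub, coeff_X_pow_mul', ← map_natCast (C (R := ℂ)), coeff_C_mul_X_pow]
  simp only [lambertTerm, coeff_mk]
  by_cases hn : i ≤ n
  · obtain ⟨m, rfl⟩ := Nat.exists_eq_add_of_le hn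
    simp [hi]
    by_cases hm : m = 0 <;> simp [hm]
  · have h1 : ¬(n ≠ 0 ∧ i ∣ n) := fun h ↦ hn (Nat.le_of_dvd (Nat.pos_of_ne_zero h.1) h.2)
    have h2 : n ≠ i := by omega
    simp [hn, h2]
    exact fun h h' ↦ absurd ⟨h, h'⟩ h1

lemma thetaOp_X_pow (i : ℕ) : thetaOp (X ^ i) = (i : ℂ⟦X⟧) * X ^ i := by
  ext n
  rw [coeff_thetaOp, ← map_natCast (C (R := ℂ)), coeff_C_mul_X_pow, coeff_X_pow]
  by_cases h : n = i <;> simp [h]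

lemma thetaOp_qPoch (N : ℕ) :
    thetaOp (qPoch N) = -(∑ i ∈ range N, lambertTerm (i + 1)) * qPoch N := by
  induction N with
  | zero => simp [qPoch]
  | succ N ih =>
    rw [qPoch_succ, Derivation.leibniz, ih, map_sub, thetaOp_X_pow, Derivation.map_one_eq_zero,
      ← one_sub_mul_lambertTerm N.succ_ne_zero, sum_range_succ]
    simp only [smul_eq_mul, Nat.succ_eq_add_one]
    ring

lemma X_pow_dvd_sum_lambertTerm (N : ℕ) : (X : ℂ⟦X⟧) ^ (N + 1) ∣
    ∑ i ∈ range N, lambertTerm (i + 1) - (1 / 24 : ℂ) • (1 - qE2) := by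
  rw [X_pow_dvd_iff]
  intro m hm
  rw [map_sub, map_sum, coeff_smul, map_sub, coeff_one]
  simp only [lambertTerm, qE2, coeff_mk]
  rcases eq_or_ne m 0 with rfl | hm0
  · simp
  · have hd : m.divisors = ((range N).image (· + 1)).filter (· ∣ m) := by
      ext d
      simp only [Nat.mem_divisors, mem_filter, mem_image, mem_range]
      constructor
      · rintro ⟨h1, -⟩
        have := Nat.le_of_dvd (Nat.pos_of_ne_zero hm0) h1
        have := Nat.pos_of_dvd_of_pos h1 (Nat.pos_of_ne_zero hm0)
        exact ⟨⟨d - 1, by omega, by omega⟩, h1⟩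
      · exact fun h ↦ ⟨h.2, hm0⟩
    simp only [hm0, ne_eq, not_false_eq_true, true_and, if_false, ArithmeticFunction.sigma_one_apply,
      hd, sum_filter]
    rw [sum_image (by simp)]
    push_cast
    simp

/-- The differential equation of `η³`, for the series `∑ (-1)ᵏ (2k + 1) q^{k(k+1)/2}`. -/
lemma thetaOp_jacobiSeries :
    thetaOp jacobiSeries = (1 / 8 : ℂ) • ((qE2 - 1) * jacobiSeries) := by
  ext N
  rw [← sub_eq_zero, ← map_sub]
  refine X_pow_dvd_iff.mp (?_ : (X : ℂ⟦X⟧) ^ (N + 1) ∣ _) N (by omega)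
  obtain ⟨u, hu⟩ := X_pow_dvd_jacobiSeries_sub N
  obtain ⟨w, hw⟩ := X_pow_dvd_sum_lambertTerm N
  have hX := thetaOp_X_pow (N + 1)
  have h1 := thetaOp_qPoch N
  have h2 : thetaOp (jacobiSeries - qPoch N ^ 3) =
      X ^ (N + 1) * (thetaOp u + ((N + 1 : ℕ) : ℂ⟦X⟧) * u) := by
    rw [hu, Derivation.leibniz, hX, smul_eq_mul, smul_eq_mul]
    ring
  rw [map_sub, Derivation.leibniz_pow, h1] at h2
  have hJ : jacobiSeries = qPoch N ^ 3 + X ^ (N + 1) * u := by rw [← hu]; ring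
  have hw' : ∑ i ∈ range N, lambertTerm (i + 1) =
    (1 / 24 : ℂ) • (1 - qE2) + X ^ (N + 1) * w := by rw [← hw]; ring
  rw [hw', smul_eq_C_mul] at h2
  have hC : (C (1 / 8 : ℂ) : ℂ⟦X⟧) = 3 * C (1 / 24 : ℂ) := by
    rw [← map_ofNat C 3, ← map_mul]
    norm_num
  refine ⟨thetaOp u + ((N + 1 : ℕ) : ℂ⟦X⟧) * u - 3 * w * qPoch N ^ 3
    - C (1 / 8 : ℂ) * (qE2 - 1) * u, ?_⟩
  rw [smul_eq_C_mul, hC]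
  simp only [smul_eq_mul, nsmul_eq_mul] at h2
  push_cast at h2 ⊢
  linear_combination h2 - 3 * C (1 / 24 : ℂ) * (qE2 - 1) * hJ

end EtaCubed

/-! ### Generating function of `3`-colored partitions -/

section ColoredPartitions

open Finset

section Multisets

variable {α : Type*} (w : α → ℕ)

/-- The multisets with elements in `S` and total weight `n`. -/
def weightedMultisets (S : Finset α) (n : ℕ) : Set (Multiset α) :=
  {m | (∀ x ∈ m, x ∈ S) ∧ (m.map w).sum = n}

variable {w}

lemma weightedMultisets_empty (n : ℕ) :
    weightedMultisets w ∅ n = if n = 0 then {0} else ∅ := by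
  ext m
  have h : (∀ x ∈ m, x ∈ (∅ : Finset α)) ↔ m = 0 := by
    simp [Multiset.eq_zero_iff_forall_notMem]
  rw [weightedMultisets, Set.mem_ofPred_eq, h]
  split_ifs with hn
  · subst hn
    simp +contextual
  · simp only [Set.mem_empty_iff_false, iff_false]
    rintro ⟨rfl, h0⟩
    exact hn (by simpa using h0.symm)

variable [DecidableEq α]

/-- A multiset in `insert a S` either avoids `a` or arises by adding one copy of `a`. -/
lemma weightedMultisets_insert {S : Finset α} {a : α} (n : ℕ) :
    weightedMultisets w (insert a S) n = weightedMultisets w S n ∪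
      if w a ≤ n then (a ::ₘ ·) '' weightedMultisets w (insert a S) (n - w a) else ∅ := by
  ext m
  simp only [weightedMultisets, Set.mem_union, Set.mem_ofPred_eq]
  constructor
  · rintro ⟨h1, h2⟩
    by_cases ha : a ∈ m
    · right
      obtain ⟨m', rfl⟩ := Multiset.exists_cons_of_mem ha
      rw [Multiset.map_cons, Multiset.sum_cons] at h2
      rw [if_pos (by omega)]
      exact ⟨m', ⟨fun x hx ↦ h1 x (Multiset.mem_cons_of_mem hx), by omega⟩, rfl⟩
    · left
      refine ⟨fun x hx ↦ (Finset.mem_insert.mp (h1 x hx)).resolve_left ?_, h2⟩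
      rintro rfl
      exact ha hx
  · rintro (⟨h1, h2⟩ | h)
    · exact ⟨fun x hx ↦ Finset.mem_insert_of_mem (h1 x hx), h2⟩
    · split_ifs at h with hw
      · obtain ⟨m', ⟨h1, h2⟩, rfl⟩ := h
        refine ⟨fun x hx ↦ ?_, ?_⟩
        · rcases Multiset.mem_cons.mp hx with rfl | hx
          · exact Finset.mem_insert_self _ _
          · exact h1 x hx
        · rw [Multiset.map_cons, Multiset.sum_cons]
          omega
      · exact h.elim

lemma finite_weightedMultisets (hw : ∀ a, 0 < w a) (S : Finset α) (n : ℕ) :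
    (weightedMultisets w S n).Finite := by
  induction S using Finset.induction_on generalizing n with
  | empty => rw [weightedMultisets_empty]; split_ifs <;> simp
  | insert a S _ ih =>
    induction n using Nat.strong_induction_on with
    | _ n ihn =>
      rw [weightedMultisets_insert]
      refine (ih n).union ?_
      split_ifs with h
      · exact (ihn _ (by have := hw a; omega)).image _
      · exact Set.finite_empty

variable (w) in
/-- The generating series of `weightedMultisets w S`. -/
noncomputable def multisetSeries (S : Finset α) : ℂ⟦X⟧ :=
  .mk fun n ↦ ((weightedMultisets w S n).ncard : ℂ)

lemma multisetSeries_mul_prod (hw : ∀ a, 0 < w a) (S : Finset α) :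
    multisetSeries w S * ∏ a ∈ S, (1 - X ^ w a) = 1 := by
  induction S using Finset.induction_on with
  | empty =>
    ext n
    simp only [multisetSeries, prod_empty, mul_one, coeff_mk, weightedMultisets_empty, coeff_one]
    split_ifs <;> simp
  | insert a S ha ih =>
    suffices h : multisetSeries w (insert a S) * (1 - X ^ w a) = multisetSeries w S by
      rw [prod_insert ha, ← mul_assoc, h, ih]
    ext n
    rw [mul_sub, mul_one, map_sub, coeff_mul_X_pow']
    simp only [multisetSeries, coeff_mk]
    rw [weightedMultisets_insert n, Set.ncard_union_eq ?_ (finite_weightedMultisets hw S n) ?_]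
    · split_ifs with h
      · rw [Set.ncard_image_of_injective _ (fun _ _ h ↦ (Multiset.cons_inj_right a).mp h)]
        simp
      · simp
    · rw [Set.disjoint_left]
      rintro m ⟨h1, -⟩ h2
      split_ifs at h2 with h
      · obtain ⟨m', -, rfl⟩ := h2
        exact ha (h1 a (Multiset.mem_cons_self a m'))
      · exact h2
    · split_ifs with h
      · exact (finite_weightedMultisets hw _ _).image _
      · exact Set.finite_empty

end Multisets

/-- The generating series of `3`-colored partitions. -/
noncomputable def coloredSeries : ℂ⟦X⟧ := .mk fun n ↦ (coloredPartitionCount 3 (n : ℤ) : ℂ)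

/-- The colored parts of size at most `N`. -/
def coloredParts (N : ℕ) : Finset (ℕ+ × Fin 3) := (range N).image Nat.succPNat ×ˢ univ

lemma coloredPartitionCount_eq {n N : ℕ} (h : n ≤ N) :
    coloredPartitionCount 3 (n : ℤ) =
      (weightedMultisets (fun p : ℕ+ × Fin 3 ↦ (p.1 : ℕ)) (coloredParts N) n).ncard := by
  rw [coloredPartitionCount, ← Nat.card_coe_set_eq]
  refine Nat.card_congr (Equiv.subtypeEquivRight fun m ↦ ?_)
  have hsum : (m.map fun p ↦ ((p.1 : ℕ) : ℤ)).sum = ((m.map fun p ↦ (p.1 : ℕ)).sum : ℤ) := by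
    rw [Nat.cast_multiset_sum, Multiset.map_map]
    rfl
  rw [hsum, Nat.cast_inj, weightedMultisets]
  refine ⟨fun h1 ↦ ⟨fun x hx ↦ ?_, h1⟩, fun h1 ↦ h1.2⟩
  have hle : (x.1 : ℕ) ≤ n :=
    h1 ▸ Multiset.single_le_sum (fun _ _ ↦ Nat.zero_le _) _ (Multiset.mem_map_of_mem _ hx)
  have hpos := x.1.pos
  simp only [coloredParts, mem_product, mem_image, mem_range, mem_univ, and_true]
  exact ⟨(x.1 : ℕ) - 1, by omega, PNat.eq (by simp; omega)⟩

lemma coloredPartitionCount_of_neg {n : ℤ} (h : n < 0) : coloredPartitionCount 3 n = 0 := by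
  have : IsEmpty (ColoredPartition 3 n) := ⟨fun m ↦ by
    have h0 : 0 ≤ (m.1.map fun p ↦ ((p.1 : ℕ) : ℤ)).sum :=
      Multiset.sum_nonneg fun x hx ↦ by
        obtain ⟨p, -, rfl⟩ := Multiset.mem_map.mp hx
        positivity
    rw [m.2] at h0
    omega⟩
  rw [coloredPartitionCount, Nat.card_of_isEmpty]

lemma X_pow_dvd_coloredSeries_sub (N : ℕ) : (X : ℂ⟦X⟧) ^ (N + 1) ∣
    coloredSeries - multisetSeries (fun p : ℕ+ × Fin 3 ↦ (p.1 : ℕ)) (coloredParts N) := by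
  rw [X_pow_dvd_iff]
  intro m hm
  rw [map_sub, coloredSeries, multisetSeries, coeff_mk, coeff_mk,
    coloredPartitionCount_eq (Nat.lt_succ_iff.mp hm), sub_self]

lemma prod_coloredParts (N : ℕ) :
    ∏ p ∈ coloredParts N, (1 - X ^ (p.1 : ℕ) : ℂ⟦X⟧) = qPoch N ^ 3 := by
  rw [coloredParts, prod_product]
  simp only [prod_const, card_univ, Fintype.card_fin]
  rw [prod_pow, prod_image (fun _ _ _ _ h ↦ Nat.succPNat_injective h), qPoch]
  simp

/-- By Jacobi's identity, `∑ (-1)ᵏ (2k + 1) q^{k(k+1)/2}` is the inverse of the generating series of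
`3`-colored partitions. -/
lemma coloredSeries_mul_jacobiSeries : coloredSeries * jacobiSeries = 1 := by
  ext N
  rw [← sub_eq_zero, ← map_sub]
  refine X_pow_dvd_iff.mp (?_ : (X : ℂ⟦X⟧) ^ (N + 1) ∣ _) N (by omega)
  obtain ⟨u, hu⟩ := X_pow_dvd_jacobiSeries_sub N
  obtain ⟨w, hw⟩ := X_pow_dvd_coloredSeries_sub N
  have h := multisetSeries_mul_prod (w := fun p : ℕ+ × Fin 3 ↦ (p.1 : ℕ)) (fun p ↦ p.1.pos)
    (coloredParts N)
  rw [prod_coloredParts] at h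
  refine ⟨coloredSeries * u + w * qPoch N ^ 3, ?_⟩
  linear_combination coloredSeries * hu + qPoch N ^ 3 * hw + h

lemma thetaOp_jacobiSeries_add : thetaOp jacobiSeries + ((3 / 2 : ℂ) / 12) • jacobiSeries =
    (3 / 2 : ℂ) • (qY * jacobiSeries) := by
  rw [thetaOp_jacobiSeries, qY, smul_mul_assoc, smul_smul, sub_mul, one_mul, smul_sub]
  norm_num

lemma thetaOp_coloredSeries_add : thetaOp coloredSeries + ((-3 / 2 : ℂ) / 12) • coloredSeries =
    (-3 / 2 : ℂ) • (qY * coloredSeries) := by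
  have h1 := congrArg thetaOp coloredSeries_mul_jacobiSeries
  rw [Derivation.leibniz, Derivation.map_one_eq_zero, thetaOp_jacobiSeries] at h1
  have h2 : thetaOp coloredSeries = -((1 / 8 : ℂ) • ((qE2 - 1) * coloredSeries)) := by
    simp only [smul_eq_mul, smul_eq_C_mul] at h1 ⊢
    linear_combination coloredSeries * h1 - (thetaOp coloredSeries +
      C (1 / 8 : ℂ) * (qE2 - 1) * coloredSeries) * coloredSeries_mul_jacobiSeries
  rw [h2, qY, smul_mul_assoc, smul_smul, sub_mul, one_mul, smul_sub]
  norm_num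
  module

end ColoredPartitions

/-! ### The Rankin–Cohen bracket of `η⁻³` and `η³` -/

section Coefficients

open Finset HasAntidiagonal

/-- The rational coefficient of `(2k + 1)^(2s + 1) (8n - (2k + 1)²)^r` in `calE v n k`,
where `s = v - r`. -/
def calECoeff (v r : ℕ) : ℚ :=
  (-1) ^ r / 8 ^ v * (((∏ i ∈ Ico r v, ((i : ℚ) - 3 / 2)) * ∏ i ∈ Ico (v - r) v, ((i : ℚ) + 3 / 2)) /
    ((v - r).factorial * r.factorial))

lemma Gamma_add_natCast {a : ℝ} (ha : ∀ n : ℕ, a + n ≠ 0) {m n : ℕ} (h : m ≤ n) :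
    Real.Gamma (n + a) = Real.Gamma (m + a) * ∏ i ∈ Ico m n, ((i : ℝ) + a) := by
  induction n, h using Nat.le_induction with
  | base => simp
  | succ n hmn ih =>
    rw [prod_Ico_succ_top hmn, ← mul_assoc, ← ih, mul_comm, ← Real.Gamma_add_one]
    · congr 1
      push_cast
      ring
    · rw [add_comm]; exact ha n

lemma half_int_add_ne_zero {a : ℤ} (ha : Odd a) (n : ℕ) : (a / 2 : ℝ) + n ≠ 0 := by
  intro h
  have h1 : (a : ℝ) + 2 * n = 0 := by linarith
  have h2 : a + 2 * n = 0 := by exact_mod_cast h1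
  obtain ⟨b, rfl⟩ := ha
  omega

lemma Gamma_add_natCast_ne_zero {a : ℝ} (ha : ∀ n : ℕ, a + n ≠ 0) (n : ℕ) :
    Real.Gamma (n + a) ≠ 0 :=
  Real.Gamma_ne_zero fun m h ↦ ha (n + m) (by push_cast; linarith)

lemma neg_three_half_add_ne_zero (n : ℕ) : (-(3 / 2) : ℝ) + n ≠ 0 := by
  have := half_int_add_ne_zero (a := -3) (by decide) n
  norm_num at this ⊢
  exact this

lemma three_half_add_ne_zero (n : ℕ) : (3 / 2 : ℝ) + n ≠ 0 := by positivity

lemma calE_eq_sum (v n k : ℕ) :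
    calE v n k = ∑ x ∈ antidiagonal v, (calECoeff v x.1 : ℝ) *
      (2 * (k : ℝ) + 1) ^ (2 * x.2 + 1) * (8 * (n : ℝ) - (2 * (k : ℝ) + 1) ^ 2) ^ x.1 := by
  refine sum_congr rfl fun x hx ↦ ?_
  obtain ⟨r, s⟩ := x
  obtain rfl : r + s = v := mem_antidiagonal.mp hx
  have h1 := Gamma_add_natCast neg_three_half_add_ne_zero (m := r) (n := r + s) (by omega)
  have h2 := Gamma_add_natCast three_half_add_ne_zero (m := s) (n := r + s) (by omega)
  have h3 := Gamma_add_natCast_ne_zero neg_three_half_add_ne_zero r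
  have h4 := Gamma_add_natCast_ne_zero three_half_add_ne_zero s
  simp only [← sub_eq_add_neg] at h1 h3
  congr 2
  rw [h1, h2, calECoeff, Nat.add_sub_cancel_left]
  push_cast
  generalize Real.Gamma ((r : ℝ) - 3 / 2) = G at *
  generalize Real.Gamma ((s : ℝ) + 3 / 2) = G' at *
  generalize ∏ i ∈ Ico r (r + s), ((i : ℝ) - 3 / 2) = p
  generalize ∏ i ∈ Ico s (r + s), ((i : ℝ) + 3 / 2) = p'
  field_simp

lemma ascPochhammer_eval_mul_prod (a : ℂ) {m n : ℕ} (h : m ≤ n) :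
    (ascPochhammer ℂ m).eval a * ∏ i ∈ Ico m n, ((i : ℂ) + a) = (ascPochhammer ℂ n).eval a := by
  induction n, h using Nat.le_induction with
  | base => simp
  | succ n hmn ih =>
    rw [prod_Ico_succ_top hmn, ← mul_assoc, ih, ascPochhammer_succ_eval, add_comm]

lemma ascPochhammer_eval_ne_zero {a : ℂ} (ha : ∀ n : ℕ, a + n ≠ 0) (n : ℕ) :
    (ascPochhammer ℂ n).eval a ≠ 0 := by
  induction n with
  | zero => simp
  | succ n ih => rw [ascPochhammer_succ_eval]; exact mul_ne_zero ih (ha n)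

lemma neg_three_half_add_ne_zero' (n : ℕ) : (-3 / 2 : ℂ) + n ≠ 0 := by
  have := Complex.ofReal_ne_zero.mpr (neg_three_half_add_ne_zero n)
  push_cast at this
  rwa [neg_div]

lemma three_half_add_ne_zero' (n : ℕ) : (3 / 2 : ℂ) + n ≠ 0 := by
  have := Complex.ofReal_ne_zero.mpr (three_half_add_ne_zero n)
  push_cast at this
  exact this

/-- The generating function of `∑ₖ (-1)ᵏ 𝓔_v(n, k) 𝔭₃(n - T_k)`. -/
noncomputable def bracketSeries (v : ℕ) : ℂ⟦X⟧ :=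
  .mk fun n ↦ ∑ k ∈ range (n + 1), (-1) ^ k * (calE v n k : ℂ) *
    (coloredPartitionCount 3 ((n : ℤ) - triangular k) : ℂ)

lemma eight_mul_triangular (k : ℕ) : 8 * triangular k + 1 = (2 * k + 1) ^ 2 := by
  induction k with
  | zero => rfl
  | succ k ih => rw [triangular_succ]; linarith

lemma sum_antidiagonal_mul_jacobiSeries (φ : ℕ → ℕ → ℂ) (n : ℕ) :
    ∑ x ∈ antidiagonal n, φ x.1 x.2 * coeff x.2 jacobiSeries =
      ∑ k ∈ range (n + 1), if triangular k ≤ n then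
        φ (n - triangular k) (triangular k) * ((-1) ^ k * (2 * k + 1)) else 0 := by
  have h1 : ∀ x ∈ antidiagonal n, φ x.1 x.2 * coeff x.2 jacobiSeries = ∑ k ∈ range (n + 1),
      if triangular k = x.2 then φ x.1 x.2 * ((-1) ^ k * (2 * k + 1)) else 0 := by
    intro x hx
    have hx' := mem_antidiagonal.mp hx
    rw [jacobiSeries, coeff_mk, mul_sum]
    simp only [mul_ite, mul_zero]
    refine sum_subset (range_mono (by omega)) fun k _ hk ↦ if_neg fun h ↦ hk ?_
    have := le_triangular k
    simp; omega
  rw [sum_congr rfl h1, sum_comm]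
  refine sum_congr rfl fun k _ ↦ ?_
  split_ifs with hk
  · rw [sum_eq_single (n - triangular k, triangular k)]
    · simp
    · rintro ⟨a, b⟩ hx hne
      refine if_neg fun h ↦ hne ?_
      have := mem_antidiagonal.mp hx
      simp at h this ⊢
      omega
    · intro h
      exact absurd (HasAntidiagonal.mem_antidiagonal.mpr (by simp; omega)) h
  · refine sum_eq_zero fun x hx ↦ if_neg fun h ↦ hk ?_
    have := mem_antidiagonal.mp hx
    omega

/-- Each term of `calE` is a product of two normalised derivatives, up to a factor depending only
on the weight `r + s`. -/
lemma calECoeff_mul_eq {n k : ℕ} (hk : triangular k ≤ n) (r s : ℕ) :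
    (calECoeff (r + s) r : ℂ) * (2 * k + 1) ^ (2 * s + 1) * (8 * n - (2 * k + 1) ^ 2) ^ r =
      (ascPochhammer ℂ (r + s)).eval (-3 / 2) * (ascPochhammer ℂ (r + s)).eval (3 / 2) *
        ((-1) ^ r *
          ((((n - triangular k : ℕ) : ℂ) + (-3 / 2) / 12) ^ r /
            (r.factorial * (ascPochhammer ℂ r).eval (-3 / 2))) *
          (((triangular k : ℂ) + (3 / 2) / 12) ^ s /
            (s.factorial * (ascPochhammer ℂ s).eval (3 / 2)))) * (2 * k + 1) := by
  have hT : (8 : ℂ) * triangular k + 1 = (2 * k + 1) ^ 2 := by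
    exact_mod_cast eight_mul_triangular k
  have e1 : (((n - triangular k : ℕ) : ℂ) + (-3 / 2) / 12) = (8 * n - (2 * k + 1) ^ 2) / 8 := by
    rw [← hT]
    push_cast [hk]
    ring
  have e2 : ((triangular k : ℂ) + (3 / 2) / 12) = (2 * k + 1) ^ 2 / 8 := by
    rw [← hT]
    ring
  have e4 := ascPochhammer_eval_mul_prod (-3 / 2) (m := r) (n := r + s) (by omega)
  have e5 := ascPochhammer_eval_mul_prod (3 / 2) (m := s) (n := r + s) (by omega)
  have e6 := ascPochhammer_eval_ne_zero neg_three_half_add_ne_zero' r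
  have e7 := ascPochhammer_eval_ne_zero three_half_add_ne_zero' s
  have e8 : (r.factorial : ℂ) ≠ 0 := by exact_mod_cast r.factorial_ne_zero
  have e9 : (s.factorial : ℂ) ≠ 0 := by exact_mod_cast s.factorial_ne_zero
  rw [e1, e2, ← e4, ← e5, calECoeff, Nat.add_sub_cancel_left]
  push_cast
  rw [show (∏ i ∈ Ico r (r + s), ((i : ℂ) - 3 / 2)) = ∏ i ∈ Ico r (r + s), ((i : ℂ) + -3 / 2) from
    prod_congr rfl fun i _ ↦ by ring]
  clear e1 e2 e4 e5 hT
  generalize (∏ i ∈ Ico r (r + s), ((i : ℂ) + -3 / 2)) = p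
  generalize (∏ i ∈ Ico s (r + s), ((i : ℂ) + 3 / 2)) = p'
  generalize (ascPochhammer ℂ r).eval (-3 / 2) = A at *
  generalize (ascPochhammer ℂ s).eval (3 / 2) = B at *
  generalize (2 * (k : ℂ) + 1) = c
  generalize (8 * (n : ℂ) - c ^ 2) = d
  generalize (r.factorial : ℂ) = u at *
  generalize (s.factorial : ℂ) = w at *
  rw [div_pow d, div_pow (c ^ 2), pow_succ c, pow_mul c, pow_add (8 : ℂ)]
  field_simp

/-- The Rankin–Cohen bracket of `η⁻³` and `η³` is a modular form. -/
lemma bracketSeries_mem_modularQExp (v : ℕ) : bracketSeries v ∈ modularQExp (2 * v) := by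
  set P := fun n ↦ twistedSeq thetaOp qY qH (-3 / 2) n * coloredSeries with hP
  set Q := fun n ↦ twistedSeq thetaOp qY qH (3 / 2) n * jacobiSeries with hQ
  have hPQ : ∑ x ∈ antidiagonal v, (-1) ^ x.1 * (P x.1 * Q x.2) ∈ modularQExp (2 * v) := by
    have h1 : ∑ x ∈ antidiagonal v, (-1) ^ x.1 * (P x.1 * Q x.2) =
        ∑ x ∈ antidiagonal v, (-1) ^ x.1 * (serreSeq thetaOp qY qH (-3 / 2) x.1 *
          serreSeq thetaOp qY qH (3 / 2) x.2) := by
      rw [← sum_twistedSeq_mul]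
      refine sum_congr rfl fun x _ ↦ ?_
      linear_combination ((-1) ^ x.1 * (twistedSeq thetaOp qY qH (-3 / 2) x.1 *
        twistedSeq thetaOp qY qH (3 / 2) x.2)) * coloredSeries_mul_jacobiSeries
    rw [h1]
    refine Submodule.sum_mem _ fun x hx ↦ ?_
    have h2 := mul_mem_modularQExp (serreSeq_mem_modularQExp (-3 / 2) x.1)
      (serreSeq_mem_modularQExp (3 / 2) x.2)
    have h3 : (2 * x.1 + 2 * x.2 : ℤ) = 2 * v := by rw [← mem_antidiagonal.mp hx]; push_cast; ring
    rw [h3] at h2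
    have h4 := (modularQExp (2 * v)).smul_mem ((-1) ^ x.1) h2
    convert h4 using 1
    rw [smul_eq_C_mul]
    simp
  convert (modularQExp (2 * v)).smul_mem
    ((ascPochhammer ℂ v).eval (-3 / 2) * (ascPochhammer ℂ v).eval (3 / 2)) hPQ using 1
  ext n
  have hterm (r s : ℕ) : coeff n ((-1) ^ r * (P r * Q s)) =
      ∑ k ∈ range (n + 1), if triangular k ≤ n then
        ((-1) ^ r * ((((n - triangular k : ℕ) : ℂ) + (-3 / 2) / 12) ^ r /
          (r.factorial * (ascPochhammer ℂ r).eval (-3 / 2)) *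
            coeff (n - triangular k) coloredSeries *
          (((triangular k : ℂ) + (3 / 2) / 12) ^ s /
            (s.factorial * (ascPochhammer ℂ s).eval (3 / 2))))) * ((-1) ^ k * (2 * k + 1))
        else 0 := by
    rw [← sum_antidiagonal_mul_jacobiSeries (fun a b ↦ (-1) ^ r * (((a : ℂ) + (-3 / 2) / 12) ^ r /
          (r.factorial * (ascPochhammer ℂ r).eval (-3 / 2)) * coeff a coloredSeries *
          (((b : ℂ) + (3 / 2) / 12) ^ s /
            (s.factorial * (ascPochhammer ℂ s).eval (3 / 2))))),
      show (-1 : ℂ⟦X⟧) ^ r = C ((-1) ^ r) by simp, coeff_C_mul, coeff_mul, mul_sum]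
    refine sum_congr rfl fun x _ ↦ ?_
    simp only [hP, hQ]
    rw [coeff_twistedSeq_mul neg_three_half_add_ne_zero' thetaOp_coloredSeries_add,
      coeff_twistedSeq_mul three_half_add_ne_zero' thetaOp_jacobiSeries_add]
    ring
  rw [coeff_smul, map_sum, sum_congr rfl fun x _ ↦ hterm x.1 x.2, sum_comm, smul_sum,
    bracketSeries, coeff_mk]
  refine sum_congr rfl fun k _ ↦ ?_
  by_cases hk : triangular k ≤ n
  · simp only [if_pos hk]
    rw [calE_eq_sum]
    push_cast
    rw [mul_sum, sum_mul, smul_sum]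
    refine sum_congr rfl fun x hx ↦ ?_
    obtain ⟨r, s⟩ := x
    obtain rfl : r + s = v := mem_antidiagonal.mp hx
    have e3 : coeff (n - triangular k) coloredSeries =
        (coloredPartitionCount 3 ((n : ℤ) - triangular k) : ℂ) := by
      rw [coloredSeries, coeff_mk]
      push_cast [hk]
      rfl
    have e4 := calECoeff_mul_eq hk r s
    rw [e3, smul_eq_mul]
    linear_combination ((-1) ^ k *
      (coloredPartitionCount 3 ((n : ℤ) - triangular k) : ℂ)) * e4
  · simp only [if_neg hk, sum_const_zero, smul_zero]
    rw [coloredPartitionCount_of_neg (by omega)]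
    simp

lemma coeff_zero_jacobiSeries : coeff 0 jacobiSeries = 1 := by
  simp [jacobiSeries, triangular]

lemma coeff_one_jacobiSeries : coeff 1 jacobiSeries = -3 := by
  simp [jacobiSeries, sum_range_succ, triangular]
  norm_num

lemma coloredPartitionCount_zero : (coloredPartitionCount 3 0 : ℂ) = 1 := by
  have h := congrArg (coeff 0) coloredSeries_mul_jacobiSeries
  simpa [coeff_mul, coloredSeries, coeff_zero_jacobiSeries] using h

lemma coloredPartitionCount_one : (coloredPartitionCount 3 1 : ℂ) = 3 := by
  have h := congrArg (coeff 1) coloredSeries_mul_jacobiSeries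
  have h0 : constantCoeff jacobiSeries = 1 := by simpa using coeff_zero_jacobiSeries
  rw [coeff_mul, Nat.sum_antidiagonal_succ] at h
  simp [coloredSeries, coeff_one_jacobiSeries, coloredPartitionCount_zero, coeff_one, h0] at h
  linear_combination h

end Coefficients

/-! ### Level one forms determined by their first coefficients -/

section CuspForms

open ModularForm

lemma CuspForm.eq_zero_of_weight {k : ℤ} (hk : k < 12 ∨ k = 14) (f : CuspForm 𝒮ℒ k) : f = 0 := by
  rw [← CuspForm.discriminantEquiv.map_eq_zero_iff]
  rcases hk with hk | rfl
  · exact rank_zero_iff_forall_zero.mp (levelOne_neg_weight_rank_zero (by omega)) _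
  · exact rank_zero_iff_forall_zero.mp levelOne_weight_two_rank_zero _

lemma eq_zero_of_mem_modularQExp {k : ℤ} (hk : k < 12 ∨ k = 14) {p : ℂ⟦X⟧}
    (hp : p ∈ modularQExp k) (h0 : coeff 0 p = 0) : p = 0 := by
  obtain ⟨f, rfl⟩ := hp
  have h := CuspForm.eq_zero_of_weight hk (toCuspForm f h0)
  have h' : (f : ℍ → ℂ) = 0 := congrArg (DFunLike.coe (F := CuspForm 𝒮ℒ k)) h
  rw [h', qExpansion_zero]

lemma constantCoeff_discriminant : constantCoeff (qExpansion 1 ModularForm.discriminant) = 0 := by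
  rw [← coeff_zero_eq_constantCoeff_apply]
  refine coeff_of_lt_order _ ?_
  rw [discriminant_qExpansion_order]
  exact_mod_cast one_pos

/-- In the weights where the space of cusp forms has dimension at most one, a modular form is
determined by its first two Fourier coefficients: dividing a cusp form by `Δ` lowers the
weight to one of those covered by `eq_zero_of_mem_modularQExp`. -/
lemma eq_zero_of_mem_modularQExp' {k : ℤ} (hk : k < 24 ∨ k = 26) {p : ℂ⟦X⟧}
    (hp : p ∈ modularQExp k) (h0 : coeff 0 p = 0) (h1 : coeff 1 p = 0) : p = 0 := by
  obtain ⟨f, rfl⟩ := hp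
  have hf := qExpansion_eq_qExpansion_discriminant_mul f h0
  set g := CuspForm.discriminantEquiv (toCuspForm f h0)
  have hg0 : coeff 0 (qExpansion 1 g) = 0 := by
    rw [hf, coeff_mul, Finset.Nat.sum_antidiagonal_succ] at h1
    simpa [constantCoeff_discriminant, CuspForm.coe_discriminant,
      discriminant_qExpansion_coeff_one] using h1
  rw [hf, eq_zero_of_mem_modularQExp (by omega) ⟨g, rfl⟩ hg0, mul_zero]

lemma cuspForm_qExpansion_mem {k : ℤ} (f : CuspForm 𝒮ℒ k) :
    qExpansion 1 f ∈ modularQExp k := ⟨CuspForm.toModularFormₗ f, rfl⟩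

lemma cuspForm_qExpansion_coeff_zero {k : ℤ} (f : CuspForm 𝒮ℒ k) :
    coeff 0 (qExpansion 1 f) = 0 :=
  CuspFormClass.qExpansion_coeff_zero f one_pos one_mem_strictPeriods_SL

/-- Multiplying a form with constant term `1` by `Δ` gives a normalised cusp form. -/
lemma exists_cuspForm_coeff_one {k : ℤ} {p : ℂ⟦X⟧} (hp : p ∈ modularQExp (k - 12))
    (h0 : coeff 0 p = 1) : ∃ f : CuspForm 𝒮ℒ k, cuspCoeff f 1 = 1 := by
  obtain ⟨g, rfl⟩ := hp
  refine ⟨CuspForm.discriminantEquiv.symm g, ?_⟩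
  have h : (CuspForm.discriminantEquiv.symm g : ℍ → ℂ) = CuspForm.discriminant * g := by
    ext z
    rfl
  rw [cuspCoeff, h, ModularForm.qExpansion_mul_coe one_pos one_mem_strictPeriods_SL,
    coeff_mul, Finset.Nat.sum_antidiagonal_succ]
  have h0' : constantCoeff (qExpansion 1 g) = 1 := by simpa using h0
  simp [constantCoeff_discriminant, CuspForm.coe_discriminant,
      discriminant_qExpansion_coeff_one, h0']

lemma existsUnique_cuspForm {v : ℕ} (hv : v ∈ ({6, 8, 9, 10, 11, 13} : Finset ℕ)) :
    ∃! f : CuspForm 𝒮ℒ (2 * (v : ℤ)), cuspCoeff f 1 = 1 := by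
  have hv' : v = 6 ∨ v = 8 ∨ v = 9 ∨ v = 10 ∨ v = 11 ∨ v = 13 := by simpa using hv
  have hex : ∃ f : CuspForm 𝒮ℒ (2 * (v : ℤ)), cuspCoeff f 1 = 1 := by
    by_cases h6 : v = 6
    · subst h6
      exact exists_cuspForm_coeff_one one_mem_modularQExp (by simp)
    · have hk : 3 ≤ 2 * v - 12 := by omega
      have hE : qExpansion 1 (E hk) ∈ modularQExp (2 * v - 12) := by
        rw [show (2 * (v : ℤ) - 12) = ((2 * v - 12 : ℕ) : ℤ) by omega]
        exact ⟨E hk, rfl⟩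
      exact exists_cuspForm_coeff_one hE
        (EisensteinSeries.E_qExpansion_coeff_zero hk (by grind))
  obtain ⟨f, hf⟩ := hex
  refine ⟨f, hf, fun g hg ↦ ?_⟩
  have h := eq_zero_of_mem_modularQExp' (k := 2 * (v : ℤ)) (by omega)
    (Submodule.sub_mem _ (cuspForm_qExpansion_mem g) (cuspForm_qExpansion_mem f))
    (by rw [map_sub, cuspForm_qExpansion_coeff_zero, cuspForm_qExpansion_coeff_zero, sub_zero])
    (by rw [map_sub]; exact sub_eq_zero.mpr (hg.trans hf.symm))
  apply CuspForm.toModularFormₗ_injective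
  rw [← sub_eq_zero, ← ModularForm.qExpansion_eq_zero_iff one_pos one_mem_strictPeriods_SL]
  rw [← h]
  exact ModularForm.qExpansion_sub one_pos one_mem_strictPeriods_SL (CuspForm.toModularFormₗ g)
    (CuspForm.toModularFormₗ f)

/-- A modular form whose weight admits no cusp forms is a multiple of the Eisenstein series. -/
lemma coeff_eq_of_no_cuspForm {v : ℕ} (hv2 : 2 ≤ v) (hv : 2 * v < 12 ∨ 2 * v = 14) {p : ℂ⟦X⟧}
    (hp : p ∈ modularQExp (2 * v)) {n : ℕ} (hn : n ≠ 0) :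
    coeff n p = -(4 * v * coeff 0 p / bernoulli (2 * v)) *
      ArithmeticFunction.sigma (2 * v - 1) n := by
  have hk : 3 ≤ 2 * v := by omega
  have hE : qExpansion 1 (E hk) ∈ modularQExp (2 * v) := ⟨E hk, rfl⟩
  have hcE := EisensteinSeries.E_qExpansion_coeff hk (even_two_mul v)
  have h := eq_zero_of_mem_modularQExp (by omega)
    (Submodule.sub_mem _ hp (Submodule.smul_mem _ (coeff 0 p) hE))
    (by rw [map_sub, coeff_smul, hcE]; simp)
  have hc := congrArg (coeff n) h
  rw [map_sub, coeff_smul, hcE, if_neg hn, map_zero, sub_eq_zero] at hc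
  rw [hc, smul_eq_mul]
  push_cast
  ring

/-- A modular form whose weight admits, up to scaling, just one cusp form is a combination of that
form and the Eisenstein series. -/
lemma coeff_eq_of_cuspForm {v : ℕ} (hv2 : 2 ≤ v) (hv : 2 * v < 24 ∨ 2 * v = 26) {p : ℂ⟦X⟧}
    (hp : p ∈ modularQExp (2 * v)) {f : CuspForm 𝒮ℒ (2 * (v : ℤ))} (hf : cuspCoeff f 1 = 1)
    {n : ℕ} (hn : n ≠ 0) :
    coeff n p = -(4 * v * coeff 0 p / bernoulli (2 * v)) *
      ArithmeticFunction.sigma (2 * v - 1) n +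
        (coeff 1 p + 4 * v * coeff 0 p / bernoulli (2 * v)) * cuspCoeff f n := by
  have hk : 3 ≤ 2 * v := by omega
  have hE : qExpansion 1 (E hk) ∈ modularQExp (2 * v) := ⟨E hk, rfl⟩
  have hcE := EisensteinSeries.E_qExpansion_coeff hk (even_two_mul v)
  have h := eq_zero_of_mem_modularQExp' (by omega)
    (Submodule.sub_mem _ (Submodule.sub_mem _ hp (Submodule.smul_mem _ (coeff 0 p) hE))
      (Submodule.smul_mem _ (coeff 1 p + 4 * v * coeff 0 p / bernoulli (2 * v))
        (cuspForm_qExpansion_mem f)))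
    (by
      rw [map_sub, map_sub, coeff_smul, coeff_smul, hcE, cuspForm_qExpansion_coeff_zero]
      simp)
    (by
      rw [map_sub, map_sub, coeff_smul, coeff_smul, hcE, if_neg one_ne_zero]
      rw [cuspCoeff] at hf
      rw [hf]
      simp only [ArithmeticFunction.sigma_one, smul_eq_mul]
      push_cast
      ring)
  have hc := congrArg (coeff n) h
  rw [map_sub, map_sub, coeff_smul, coeff_smul, hcE, if_neg hn, map_zero, sub_eq_zero,
    sub_eq_iff_eq_add] at hc
  rw [hc, cuspCoeff]
  simp only [smul_eq_mul]
  push_cast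
  ring

end CuspForms

/-! ### Evaluation of the constants, and nonvanishing of `𝓔_v(n, 0)` -/

section Evaluation

open Finset

/-- `calE v n k` as a rational number, without the Gamma function. -/
def ratCalE (v n k : ℕ) : ℚ :=
  ∑ r ∈ range (v + 1), calECoeff v r * (2 * (k : ℚ) + 1) ^ (2 * (v - r) + 1) *
    (8 * (n : ℚ) - (2 * (k : ℚ) + 1) ^ 2) ^ r

lemma calE_eq_ratCalE (v n k : ℕ) : calE v n k = (ratCalE v n k : ℝ) := by
  rw [calE_eq_sum, ratCalE, Nat.sum_antidiagonal_eq_sum_range_succ_mk]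
  push_cast
  rfl

/-- The Bernoulli numbers `B'₀, …, B'₂₆`. -/
def bernoulliTable : ℕ → ℚ
  | 0 => 1
  | 1 => 1 / 2
  | 2 => 1 / 6
  | 4 => -1 / 30
  | 6 => 1 / 42
  | 8 => -1 / 30
  | 10 => 5 / 66
  | 12 => -691 / 2730
  | 14 => 7 / 6
  | 16 => -3617 / 510
  | 18 => 43867 / 798
  | 20 => -174611 / 330
  | 22 => 854513 / 138
  | 24 => -236364091 / 2730
  | 26 => 8553103 / 6
  | _ => 0

lemma bernoulli'_eq_table {n : ℕ} (hn : n < 27) : bernoulli' n = bernoulliTable n := by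
  have htable : ∀ n < 27, bernoulliTable n =
      1 - ∑ k ∈ range n, (n.choose k : ℚ) / (n - k + 1) * bernoulliTable k := by
    decide +kernel
  induction n using Nat.strong_induction_on with
  | _ n ih =>
    rw [bernoulli'_def, htable n hn]
    congr 1
    refine sum_congr rfl fun k hk ↦ ?_
    have := mem_range.mp hk
    rw [ih k this (by omega)]

lemma ratCalE_zero_zero : ∀ v ∈ ({2, 3, 4, 5, 6, 7, 8, 9, 10, 11, 13} : Finset ℕ),
    ratCalE v 0 0 = tableAlpha v := by
  decide +kernel

lemma ratCalE_one : ∀ v ∈ ({6, 8, 9, 10, 11, 13} : Finset ℕ),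
    3 * ratCalE v 1 0 - ratCalE v 1 1 + 4 * v * tableAlpha v / bernoulliTable (2 * v) =
      tableBeta v := by
  decide +kernel

/-- If the coefficients of `calE v n 0`, as a polynomial in `8n - 1`, are integral multiples of a
common `c ≠ 0`, and the resulting integral polynomial has no zero modulo `M`, then `calE v n 0` does
not vanish. -/
lemma ratCalE_ne_zero_of_zmod {v M : ℕ} {c : ℚ}
    (hc : ∀ r ∈ range (v + 1), calECoeff v r = c * (calECoeff v r / c).num)
    (hM : ∀ x : ZMod M, ∑ r ∈ range (v + 1), ((calECoeff v r / c).num : ZMod M) * (8 * x - 1) ^ r ≠ 0)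
    (hc0 : c ≠ 0) (n : ℕ) : ratCalE v n 0 ≠ 0 := by
  have h1 : ratCalE v n 0 =
      c * ((∑ r ∈ range (v + 1), (calECoeff v r / c).num * (8 * (n : ℤ) - 1) ^ r : ℤ) : ℚ) := by
    rw [ratCalE]
    push_cast
    rw [mul_sum]
    refine sum_congr rfl fun r hr ↦ ?_
    rw [← mul_assoc, ← hc r hr]
    simp
  rw [h1]
  refine mul_ne_zero hc0 fun h ↦ hM n ?_
  have h2 := congrArg (Int.cast : ℤ → ZMod M) (Int.cast_eq_zero.mp h)
  push_cast at h2
  exact h2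

lemma ratCalE_ne_zero {v : ℕ} (hv : v ∈ ({2, 3, 4, 5, 6, 7, 8, 9, 10, 11, 13} : Finset ℕ))
    (n : ℕ) : ratCalE v n 0 ≠ 0 := by
  have hv' : v = 2 ∨ v = 3 ∨ v = 4 ∨ v = 5 ∨ v = 6 ∨ v = 7 ∨ v = 8 ∨ v = 9 ∨ v = 10 ∨ v = 11 ∨
    v = 13 := by simpa using hv
  -- Here `c` is the content of the polynomial in `8n - 1`, and `M` is a modulus without roots.
  rcases hv' with rfl | rfl | rfl | rfl | rfl | rfl | rfl | rfl | rfl | rfl | rfl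
  · exact ratCalE_ne_zero_of_zmod (M := 5) (c := 1 / 2 ^ 9) (by decide +kernel)
      (by decide +kernel) (by norm_num) n
  · exact ratCalE_ne_zero_of_zmod (M := 3) (c := 1 / 2 ^ 13) (by decide +kernel)
      (by decide +kernel) (by norm_num) n
  · exact ratCalE_ne_zero_of_zmod (M := 3) (c := 3 / 2 ^ 19) (by decide +kernel)
      (by decide +kernel) (by norm_num) n
  · exact ratCalE_ne_zero_of_zmod (M := 11) (c := 1 / 2 ^ 23) (by decide +kernel)
      (by decide +kernel) (by norm_num) n
  · exact ratCalE_ne_zero_of_zmod (M := 7) (c := 7 / 2 ^ 28) (by decide +kernel)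
      (by decide +kernel) (by norm_num) n
  · exact ratCalE_ne_zero_of_zmod (M := 17) (c := 9 / 2 ^ 32) (by decide +kernel)
      (by decide +kernel) (by norm_num) n
  · exact ratCalE_ne_zero_of_zmod (M := 11) (c := 33 / 2 ^ 39) (by decide +kernel)
      (by decide +kernel) (by norm_num) n
  · exact ratCalE_ne_zero_of_zmod (M := 9) (c := 143 / 2 ^ 43) (by decide +kernel)
      (by decide +kernel) (by norm_num) n
  · exact ratCalE_ne_zero_of_zmod (M := 5) (c := 429 / 2 ^ 48) (by decide +kernel)
      (by decide +kernel) (by norm_num) n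
  · exact ratCalE_ne_zero_of_zmod (M := 13) (c := 221 / 2 ^ 52) (by decide +kernel)
      (by decide +kernel) (by norm_num) n
  · exact ratCalE_ne_zero_of_zmod (M := 3) (c := 6783 / 2 ^ 62) (by decide +kernel)
      (by decide +kernel) (by norm_num) n

lemma calE_ne_zero {v : ℕ} (hv : v ∈ ({2, 3, 4, 5, 6, 7, 8, 9, 10, 11, 13} : Finset ℕ))
    (n : ℕ) : calE v n 0 ≠ 0 := by
  rw [calE_eq_ratCalE]
  exact_mod_cast ratCalE_ne_zero hv n

lemma coeff_zero_bracketSeries {v : ℕ}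
    (hv : v ∈ ({2, 3, 4, 5, 6, 7, 8, 9, 10, 11, 13} : Finset ℕ)) :
    coeff 0 (bracketSeries v) = (tableAlpha v : ℂ) := by
  rw [bracketSeries, coeff_mk, ← ratCalE_zero_zero v hv]
  simp [calE_eq_ratCalE, triangular, coloredPartitionCount_zero]

lemma coeff_one_bracketSeries (v : ℕ) :
    coeff 1 (bracketSeries v) = ((3 * ratCalE v 1 0 - ratCalE v 1 1 : ℚ) : ℂ) := by
  rw [bracketSeries, coeff_mk, sum_range_succ, sum_range_one]
  simp [calE_eq_ratCalE, triangular, coloredPartitionCount_zero, coloredPartitionCount_one]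
  ring

lemma tsum_pnat_eq_sum_range {K : Type*} [AddCommMonoid K] [TopologicalSpace K] [T2Space K]
    (g : ℕ → K) (n : ℕ) (hg : ∀ k, n < k → g k = 0) :
    ∑' k : ℕ+, g k = ∑ k ∈ range n, g (k + 1) := by
  rw [tsum_pnat_eq_tsum_succ (f := g)]
  exact tsum_eq_sum fun k hk ↦ hg _ (by simpa [Nat.lt_succ_iff] using hk)

lemma coloredPartitionCount_sub_triangular {n k : ℕ} (h : n < k) :
    coloredPartitionCount 3 ((n : ℤ) - triangular k) = 0 :=
  coloredPartitionCount_of_neg (by have := le_triangular k; omega)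

/-- Solving the `n`-th coefficient of the bracket for its `k = 0` term. -/
lemma coloredPartitionCount_eq_of_coeff {v n : ℕ} (h0 : calE v n 0 ≠ 0) {c : ℂ}
    (hc : coeff n (bracketSeries v) = c) :
    (coloredPartitionCount 3 n : ℂ) = 1 / (calE v n 0 : ℂ) *
      (c + ∑ k ∈ range n, (-1 : ℂ) ^ (k + 1 + 1) * (calE v n (k + 1) : ℂ) *
        (coloredPartitionCount 3 ((n : ℤ) - (triangular (k + 1) : ℤ)) : ℂ)) := by
  have h0' : (calE v n 0 : ℂ) ≠ 0 := by exact_mod_cast h0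
  rw [bracketSeries, coeff_mk, sum_range_succ'] at hc
  simp only [pow_zero, one_mul, show triangular 0 = 0 from rfl, Nat.cast_zero, sub_zero] at hc
  rw [← hc, one_div, eq_inv_mul_iff_mul_eq₀ h0', add_right_comm, ← sum_add_distrib]
  rw [sum_eq_zero fun k _ ↦ by ring, zero_add]

end Evaluation

end

theorem theorem1p2 :
    (∀ v ∈ ({2, 3, 4, 5, 7} : Finset ℕ), ∀ n : ℕ, 1 ≤ n →
      calE v n 0 ≠ 0 ∧
      (coloredPartitionCount 3 n : ℝ) =
        1 / calE v n 0 *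
          (-(4 * (v : ℝ) * (tableAlpha v : ℝ) / (bernoulli (2 * v) : ℝ)) *
              (ArithmeticFunction.sigma (2 * v - 1) n : ℝ)
            + ∑' k : ℕ+, (-1 : ℝ) ^ ((k : ℕ) + 1) * calE v n k *
                (coloredPartitionCount 3 ((n : ℤ) - (triangular k : ℤ)) : ℝ))) ∧
    (∀ v ∈ ({6, 8, 9, 10, 11, 13} : Finset ℕ),
      (∃! f : CuspForm 𝒮ℒ (2 * (v : ℤ)), cuspCoeff f 1 = 1) ∧
      ∀ f : CuspForm 𝒮ℒ (2 * (v : ℤ)), cuspCoeff f 1 = 1 →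
        ∀ n : ℕ, 1 ≤ n →
          calE v n 0 ≠ 0 ∧
          (coloredPartitionCount 3 n : ℂ) =
            1 / (calE v n 0 : ℂ) *
              (-(4 * (v : ℂ) * (tableAlpha v : ℂ) / (bernoulli (2 * v) : ℂ)) *
                  (ArithmeticFunction.sigma (2 * v - 1) n : ℂ)
                + (tableBeta v : ℂ) * cuspCoeff f n
                + ∑' k : ℕ+, (-1 : ℂ) ^ ((k : ℕ) + 1) * (calE v n k : ℂ) *
                    (coloredPartitionCount 3 ((n : ℤ) - (triangular k : ℤ)) : ℂ))) := by
  refine ⟨fun v hv n hn ↦ ?_, fun v hv ↦ ⟨existsUnique_cuspForm hv, fun f hf n hn ↦ ?_⟩⟩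
  · have hv' : v = 2 ∨ v = 3 ∨ v = 4 ∨ v = 5 ∨ v = 7 := by simpa using hv
    have hvA : v ∈ ({2, 3, 4, 5, 6, 7, 8, 9, 10, 11, 13} : Finset ℕ) := by
      simp; omega
    have h0 := calE_ne_zero hvA n
    refine ⟨h0, ?_⟩
    have hcoeff := coeff_eq_of_no_cuspForm (by omega) (by omega) (bracketSeries_mem_modularQExp v)
      (n := n) (by omega)
    have h := coloredPartitionCount_eq_of_coeff h0 hcoeff
    rw [coeff_zero_bracketSeries hvA] at h
    rw [tsum_pnat_eq_sum_range (fun k ↦ (-1 : ℝ) ^ (k + 1) * calE v n k *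
      (coloredPartitionCount 3 ((n : ℤ) - (triangular k : ℤ)) : ℝ)) n fun k hk ↦ by
        simp [coloredPartitionCount_sub_triangular hk]]
    apply Complex.ofReal_injective
    push_cast
    exact h
  · have hv' : v = 6 ∨ v = 8 ∨ v = 9 ∨ v = 10 ∨ v = 11 ∨ v = 13 := by simpa using hv
    have hvA : v ∈ ({2, 3, 4, 5, 6, 7, 8, 9, 10, 11, 13} : Finset ℕ) := by
      simp; omega
    have h0 := calE_ne_zero hvA n
    refine ⟨h0, ?_⟩
    have hcoeff := coeff_eq_of_cuspForm (by omega) (by omega) (bracketSeries_mem_modularQExp v) hf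
      (n := n) (by omega)
    have h := coloredPartitionCount_eq_of_coeff h0 hcoeff
    have hβ : PowerSeries.coeff 1 (bracketSeries v) + 4 * v * (tableAlpha v : ℂ) / bernoulli (2 * v) =
        (tableBeta v : ℂ) := by
      rw [coeff_one_bracketSeries, ← ratCalE_one v hv, ← bernoulli'_eq_table (by omega),
        bernoulli_eq_bernoulli'_of_ne_one (by omega)]
      push_cast
      rfl
    rw [coeff_zero_bracketSeries hvA, hβ] at h
    rw [tsum_pnat_eq_sum_range (fun k ↦ (-1 : ℂ) ^ (k + 1) * (calE v n k : ℂ) *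
      (coloredPartitionCount 3 ((n : ℤ) - (triangular k : ℤ)) : ℂ)) n fun k hk ↦ by
        simp [coloredPartitionCount_sub_triangular hk]]
    exact h
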